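/- **Theorem 3.3 (Complete transversal theorem for ${}_V\mathcal K$-equivalence).** Let $\mathbb K=\mathbb R$ or $\mathbb C$; "smooth" means $C^\infty$ if $\mathbb K=\mathbb R$ and holomorphic if $\mathbb K=\mathbb C$. Let $\mathcal E_p$ be the ring of germs at $0$ of smooth functions on $\mathbb K^p$, $\mathfrak m=\mathfrak m_p$ its ideal of germs vanishing at $0$, and for a smooth map germ $h:(\mathbb K^p,0)\to(\mathbb K^q,0)$ let $\theta(h)=\mathcal E_p^q$ and $h^*:\mathcal E_q\to\mathcal E_p$, $\varphi\mapsto\varphi\circ h$. Let $V$ be an arbitrary subset germ of $(\mathbb K^p,0)$. Let $\Theta_V\subseteq\mathcal E_p^p$ be the set of germs at $0$ of smooth vector fields $\xi$ whose local flow $(t,x)\mapsto\Phi_t(x)$ ($t\in\mathbb K$) preserves $V$, i.e. $x\in V\iff\Phi_t(x)\in V$ for all $(t,x)$ near $(0,0)$; let $\Theta_{V,1}$ be the set of those $\xi\in\Theta_V$ for which, for all $t$ near $0$, $\Phi_t$ fixes $0$ and has the same $1$-jet at $0$ as the identity. With $\xi(h)=\sum_i\xi_i\,\partial h/\partial x_i$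 put $$T_V\mathcal K_1(h)=\{\xi(h)\mid \xi\in\Theta_{V,1}\}+\mathfrak m_p\,h^*(\mathfrak m_q)\,\theta(h).$$ Two smooth map germs $f,\tilde f:(\mathbb K^p,0)\to(\mathbb K^q,0)$ are ${}_V\mathcal K_1$-equivalent if there is a germ of a diffeomorphism $\Psi$ of $(\mathbb K^p\times\mathbb K^q,0)$ with $\Psi(\mathbb K^p\times\{0\})=\mathbb K^p\times\{0\}$ and $\Psi(\operatorname{graph} f)=\operatorname{graph}\tilde f$ (as set germs at $0$), such that the diffeomorphism germ $\psi$ of $(\mathbb K^p,0)$ given by $\Psi(x,0)=(\psi(x),0)$ satisfies $\psi(V)=V$ and has $1$-jet at $0$ equal to the identity. Finally, $j^k(h)$ denotes the $k$-jet of $h$ at $0$, regarded as a polynomial map (the Taylor polynomial of degree $\le k$). Suppose that $\Theta_V$ is a finitely generated $\mathcal E_p$-module, let $h:(\mathbb K^p,0)\to(\mathbb K^q,0)$ be a smooth map germ, let $k\ge 0$, and let $g_1,\dots,g_s:\mathbb K^p\to\mathbb K^q$ be homogeneous polynomial maps of degree $k+1$ such that $$\mathfrak m^{k+1}\theta(h)\subseteq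 T_V\mathcal K_1(h)+\operatorname{span}_{\mathbb K}\{g_1,\dots,g_s\}+\mathfrak m^{k+2}\theta(h).$$ Then every smooth map germ $g:(\mathbb K^p,0)\to(\mathbb K^q,0)$ with $j^k(g)=j^k(h)$ is ${}_V\mathcal K_1$-equivalent to a smooth map germ $f:(\mathbb K^p,0)\to(\mathbb K^q,0)$ with $$j^{k+1}(f)=j^k(h)+\sum_{i=1}^s\alpha_i g_i\qquad\text{for some }\alpha_1,\dots,\alpha_s\in\mathbb K.$$ -/

import Mathlib

open Filter Topology
open scoped ContDiff Pointwise

noncomputable section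

namespace VK

/-- `f` is of class `C^∞` on a neighbourhood of `a`. Over `ℝ` this is smoothness near `a`, over `ℂ`
it is holomorphy near `a`. (For `𝕜 = ℝ`, `ContDiffAt 𝕜 ∞ f a` alone does not give one
neighbourhood on which `f` is `C^∞`.) -/
def SmoothNear (𝕜 : Type*) [RCLike 𝕜] {E F : Type*} [NormedAddCommGroup E] [NormedSpace 𝕜 E]
    [NormedAddCommGroup F] [NormedSpace 𝕜 F] (f : E → F) (a : E) : Prop :=
  ∀ᶠ x in 𝓝 a, ContDiffAt 𝕜 ∞ f x

/-- The ring of germs at `0` of smooth functions on `𝕜^p`. -/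
def smoothGerms (𝕜 : Type*) [RCLike 𝕜] (p : ℕ) :
    Subring (Germ (𝓝 (0 : Fin p → 𝕜)) 𝕜) where
  carrier := {φ | ∃ f : (Fin p → 𝕜) → 𝕜, SmoothNear 𝕜 f 0 ∧ φ = (f : Germ _ 𝕜)}
  mul_mem' := by
    rintro _ _ ⟨f, hf, rfl⟩ ⟨g, hg, rfl⟩
    exact ⟨f * g, by filter_upwards [hf, hg] with x h1 h2 using h1.mul h2, rfl⟩
  one_mem' := ⟨fun _ => 1, Eventually.of_forall fun _ => contDiffAt_const, rfl⟩
  add_mem' := by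
    rintro _ _ ⟨f, hf, rfl⟩ ⟨g, hg, rfl⟩
    exact ⟨f + g, by filter_upwards [hf, hg] with x h1 h2 using h1.add h2, rfl⟩
  zero_mem' := ⟨fun _ => 0, Eventually.of_forall fun _ => contDiffAt_const, rfl⟩
  neg_mem' := by
    rintro _ ⟨f, hf, rfl⟩
    exact ⟨-f, by filter_upwards [hf] with x h1 using h1.neg, rfl⟩

/-- `ℰ_p`, the ring of smooth function germs on `(𝕜^p, 0)`. -/
abbrev Ep (𝕜 : Type*) [RCLike 𝕜] (p : ℕ) : Type _ := ↥(smoothGerms 𝕜 p)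

/-- The germ at `0` of a function that is smooth near `0`. -/
def Ep.mk {𝕜 : Type*} [RCLike 𝕜] {p : ℕ} (f : (Fin p → 𝕜) → 𝕜) (hf : SmoothNear 𝕜 f 0) :
    Ep 𝕜 p :=
  ⟨(f : Germ (𝓝 (0 : Fin p → 𝕜)) 𝕜), f, hf, rfl⟩

/-- `𝔪_p`, the ideal of smooth germs that vanish at `0`. -/
def maxIdeal (𝕜 : Type*) [RCLike 𝕜] (p : ℕ) : Ideal (Ep 𝕜 p) :=
  RingHom.ker ((Germ.valueRingHom (x := (0 : Fin p → 𝕜)) (E := 𝕜)).comp (smoothGerms 𝕜 p).subtype)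

/-- The partial derivative `∂/∂x_i` on `ℰ_p`. -/
def pderiv {𝕜 : Type*} [RCLike 𝕜] {p : ℕ} (i : Fin p) (φ : Ep 𝕜 p) : Ep 𝕜 p :=
  ⟨Germ.map' (fun (f : (Fin p → 𝕜) → 𝕜) x => fderiv 𝕜 f x (Pi.single i 1))
      (fun _ _ h => (EventuallyEq.fderiv (𝕜 := 𝕜) h).mono fun x hx => by simp only [hx]) φ.1, by
    obtain ⟨_, f, hf, rfl⟩ := φ
    exact ⟨fun x => fderiv 𝕜 f x (Pi.single i 1), hf.mono fun x hx =>
      (hx.fderiv_right (m := ∞) le_rfl).clm_apply contDiffAt_const, rfl⟩⟩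

/-- A representative of a smooth map germ `(𝕜^p, 0) → (𝕜^q, 0)`; all notions below depend only on
its germ at `0`. -/
structure MapGerm (𝕜 : Type*) [RCLike 𝕜] (p q : ℕ) where
  toFun : (Fin p → 𝕜) → (Fin q → 𝕜)
  smooth' : SmoothNear 𝕜 toFun 0
  map_zero' : toFun 0 = 0

/-- The components of a map germ `h`, as an element of `θ(h) = (ℰ_p)^q`. -/
def MapGerm.comps {𝕜 : Type*} [RCLike 𝕜] {p q : ℕ} (h : MapGerm 𝕜 p q) : Fin q → Ep 𝕜 p :=
  fun j => Ep.mk (fun x => h.toFun x j) (h.smooth'.mono fun _ hx => contDiffAt_pi.1 hx j)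

theorem MapGerm.tendsto {𝕜 : Type*} [RCLike 𝕜] {p q : ℕ} (h : MapGerm 𝕜 p q) :
    Tendsto h.toFun (𝓝 0) (𝓝 0) := by
  simpa [ContinuousAt, h.map_zero'] using h.smooth'.self_of_nhds.continuousAt

/-- The ring homomorphism `h^* : ℰ_q → ℰ_p`, `φ ↦ φ ∘ h`. -/
def MapGerm.pullback {𝕜 : Type*} [RCLike 𝕜] {p q : ℕ} (h : MapGerm 𝕜 p q) :
    Ep 𝕜 q →+* Ep 𝕜 p where
  toFun φ := ⟨φ.1.compTendsto h.toFun h.tendsto, by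
    obtain ⟨_, f, hf, rfl⟩ := φ
    refine ⟨f ∘ h.toFun, ?_, rfl⟩
    filter_upwards [h.smooth', h.tendsto.eventually hf] with x h1 h2 using h2.comp x h1⟩
  map_one' := rfl
  map_zero' := rfl
  map_mul' := by
    rintro ⟨_, f, hf, rfl⟩ ⟨_, g, hg, rfl⟩
    rfl
  map_add' := by
    rintro ⟨_, f, hf, rfl⟩ ⟨_, g, hg, rfl⟩
    rfl

/-- The germ of a polynomial map `𝕜^p → 𝕜^q` in `(ℰ_p)^q`. -/
def polyGerm {𝕜 : Type*} [RCLike 𝕜] {p q : ℕ} (P : Fin q → MvPolynomial (Fin p) 𝕜) :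
    Fin q → Ep 𝕜 p :=
  fun j => Ep.mk (fun x => MvPolynomial.eval x (P j)) (Eventually.of_forall fun x =>
    ((AnalyticOnNhd.eval_mvPolynomial (P j)) x (Set.mem_univ x)).contDiffAt)

/-- `𝔪_p^n θ(h)`, where `θ(h) = (ℰ_p)^q`. -/
def powTheta (𝕜 : Type*) [RCLike 𝕜] (p q n : ℕ) : Submodule (Ep 𝕜 p) (Fin q → Ep 𝕜 p) :=
  (maxIdeal 𝕜 p ^ n) • (⊤ : Submodule (Ep 𝕜 p) (Fin q → Ep 𝕜 p))

/-- `Φ` is (a representative of the germ at `(0, 0)` of) the smooth local flow `(t, x) ↦ Φ_t(x)` of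
the vector field germ `ξ` on `𝕜^p`. The time `t` ranges over `𝕜`. -/
structure IsLocalFlow {𝕜 : Type*} [RCLike 𝕜] {p : ℕ} (ξ : Fin p → Ep 𝕜 p)
    (Φ : 𝕜 × (Fin p → 𝕜) → (Fin p → 𝕜)) : Prop where
  smooth : SmoothNear 𝕜 Φ 0
  initial : ∀ᶠ x in 𝓝 (0 : Fin p → 𝕜), Φ (0, x) = x
  ode : ∃ X : (Fin p → 𝕜) → (Fin p → 𝕜),
    (∀ i, (ξ i : Germ (𝓝 (0 : Fin p → 𝕜)) 𝕜) = ((fun x => X x i : (Fin p → 𝕜) → 𝕜) : Germ _ 𝕜)) ∧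
    ∀ᶠ z in 𝓝 (0 : 𝕜 × (Fin p → 𝕜)), HasDerivAt (fun t => Φ (t, z.2)) (X (Φ z)) z.1

/-- The local flow `Φ` preserves the germ at `0` of the set `V`. -/
def FlowPreserves {𝕜 : Type*} [RCLike 𝕜] {p : ℕ} (V : Set (Fin p → 𝕜))
    (Φ : 𝕜 × (Fin p → 𝕜) → (Fin p → 𝕜)) : Prop :=
  ∀ᶠ z in 𝓝 (0 : 𝕜 × (Fin p → 𝕜)), z.2 ∈ V ↔ Φ z ∈ V

/-- `Θ_V`: the vector field germs whose local flow preserves `V`. They need not vanish at `0`. -/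
def Theta {𝕜 : Type*} [RCLike 𝕜] {p : ℕ} (V : Set (Fin p → 𝕜)) : Set (Fin p → Ep 𝕜 p) :=
  {ξ | ∃ Φ, IsLocalFlow ξ Φ ∧ FlowPreserves V Φ}

/-- `ψ` fixes `0` and its 1-jet there is that of the identity. -/
def HasOneJetId {𝕜 : Type*} [RCLike 𝕜] {p : ℕ} (ψ : (Fin p → 𝕜) → (Fin p → 𝕜)) : Prop :=
  ψ 0 = 0 ∧ HasFDerivAt ψ (ContinuousLinearMap.id 𝕜 (Fin p → 𝕜)) 0

/-- `Θ_{V,1}`: the vector field germs whose local flow preserves `V` and consists of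
diffeomorphisms with 1-jet the identity. -/
def Theta1 {𝕜 : Type*} [RCLike 𝕜] {p : ℕ} (V : Set (Fin p → 𝕜)) : Set (Fin p → Ep 𝕜 p) :=
  {ξ | ∃ Φ, IsLocalFlow ξ Φ ∧ FlowPreserves V Φ ∧
    ∀ᶠ t in 𝓝 (0 : 𝕜), HasOneJetId fun x => Φ (t, x)}

/-- `Θ_V` is a finitely generated `ℰ_p`-module. -/
def ThetaFG {𝕜 : Type*} [RCLike 𝕜] {p : ℕ} (V : Set (Fin p → 𝕜)) : Prop :=
  ∃ N : Submodule (Ep 𝕜 p) (Fin p → Ep 𝕜 p), (N : Set (Fin p → Ep 𝕜 p)) = Theta V ∧ N.FG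

/-- `ξ(h) = ∑ i, ξ_i ∂h/∂x_i`. -/
def applyField {𝕜 : Type*} [RCLike 𝕜] {p q : ℕ} (ξ : Fin p → Ep 𝕜 p) (h : MapGerm 𝕜 p q) :
    Fin q → Ep 𝕜 p :=
  fun j => ∑ i, ξ i * pderiv i (h.comps j)

/-- The tangent space `T_V𝒦_1(h) = {ξ(h) | ξ ∈ Θ_{V,1}} + 𝔪_p h^*(𝔪_q) θ(h)`. -/
def tangentK1 {𝕜 : Type*} [RCLike 𝕜] {p q : ℕ} (V : Set (Fin p → 𝕜)) (h : MapGerm 𝕜 p q) :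
    Set (Fin q → Ep 𝕜 p) :=
  {v | ∃ ξ ∈ Theta1 V, v = applyField ξ h} +
    (((maxIdeal 𝕜 p * (maxIdeal 𝕜 q).map h.pullback) •
      (⊤ : Submodule (Ep 𝕜 p) (Fin q → Ep 𝕜 p)) : Submodule _ _) : Set (Fin q → Ep 𝕜 p))

/-- The `k`-jet at `0` of a map germ, as a polynomial map (the Taylor polynomial of degree `k`). -/
def jet {𝕜 : Type*} [RCLike 𝕜] {p q : ℕ} (k : ℕ) (h : MapGerm 𝕜 p q) (x : Fin p → 𝕜) : Fin q → 𝕜 :=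
  ∑ n ∈ Finset.range (k + 1),
    ((n.factorial : 𝕜)⁻¹) • iteratedFDeriv 𝕜 n h.toFun 0 (fun _ => x)

/-- `Ψ` represents a germ at `0` of a diffeomorphism `(E, 0) → (E, 0)`. -/
def IsDiffeoGerm (𝕜 : Type*) [RCLike 𝕜] {E : Type*} [NormedAddCommGroup E] [NormedSpace 𝕜 E]
    (Ψ : E → E) : Prop :=
  Ψ 0 = 0 ∧ SmoothNear 𝕜 Ψ 0 ∧ ∃ Ψ' : E → E, Ψ' 0 = 0 ∧ SmoothNear 𝕜 Ψ' 0 ∧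
    (∀ᶠ z in 𝓝 (0 : E), Ψ' (Ψ z) = z) ∧ ∀ᶠ z in 𝓝 (0 : E), Ψ (Ψ' z) = z

/-- For a diffeomorphism germ `Ψ`: the equality `Ψ(A) = B` of germs at `0` of sets. -/
def MapsGermOnto {E : Type*} [NormedAddCommGroup E] (Ψ : E → E) (A B : Set E) : Prop :=
  ∀ᶠ z in 𝓝 (0 : E), z ∈ A ↔ Ψ z ∈ B

/-- The graph of a map germ. -/
def MapGerm.graph {𝕜 : Type*} [RCLike 𝕜] {p q : ℕ} (f : MapGerm 𝕜 p q) :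
    Set ((Fin p → 𝕜) × (Fin q → 𝕜)) :=
  {z | z.2 = f.toFun z.1}

/-- `Ψ` is a `𝒦`-equivalence from `f` to `f'`: a diffeomorphism germ of `(𝕜^p × 𝕜^q, 0)` that maps
`𝕜^p × {0}` onto itself and the graph of `f` onto the graph of `f'`. -/
structure IsKEquivalence {𝕜 : Type*} [RCLike 𝕜] {p q : ℕ} (f f' : MapGerm 𝕜 p q)
    (Ψ : (Fin p → 𝕜) × (Fin q → 𝕜) → (Fin p → 𝕜) × (Fin q → 𝕜)) : Prop where
  diffeo : IsDiffeoGerm 𝕜 Ψ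
  preserves_zero : MapsGermOnto Ψ {z | z.2 = 0} {z | z.2 = 0}
  maps_graph : MapsGermOnto Ψ f.graph f'.graph

/-- The diffeomorphism germ of `(𝕜^p, 0)` that a `𝒦`-equivalence `Ψ` determines by restriction to
`𝕜^p × {0}`. -/
def baseMap {𝕜 : Type*} [RCLike 𝕜] {p q : ℕ}
    (Ψ : (Fin p → 𝕜) × (Fin q → 𝕜) → (Fin p → 𝕜) × (Fin q → 𝕜)) (x : Fin p → 𝕜) : Fin p → 𝕜 :=
  (Ψ (x, 0)).1

/-- `f` and `f'` are `_V𝒦_1`-equivalent: there is a `𝒦`-equivalence whose diffeomorphism of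
`(𝕜^p, 0)` preserves `V` and has 1-jet the identity. -/
def VK1Equiv {𝕜 : Type*} [RCLike 𝕜] {p q : ℕ} (V : Set (Fin p → 𝕜)) (f f' : MapGerm 𝕜 p q) : Prop :=
  ∃ Ψ, IsKEquivalence f f' Ψ ∧ MapsGermOnto (baseMap Ψ) V V ∧ HasOneJetId (baseMap Ψ)

end VK

end

/-! Write ≡ for equality modulo germs that are O(‖x‖^(k+2)), and let φ be the homogeneous part of
degree k + 1 of g. Since φ lies in 𝔪^(k+1)θ(h), the hypothesis gives φ = ξ(h) + w + P + r with ξ ∈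
Θ_{V,1}, w ∈ 𝔪 h^*(𝔪_q)θ(h), P = ∑ αᵢ Gᵢ and r ≡ 0. As 𝔪_q is generated by the coordinates modulo
high order, w ≡ B h for a matrix B with entries in 𝔪. Hence e = φ - P satisfies ξ(h) + B h ≡ e, and
it suffices to move g within its equivalence class to a germ f ≡ g - e.

The flow of ξ does this for a small time t, without solving a differential equation for the matrix
part. Because ξ vanishes to second order (`IsUniformFlow.mem_vanishIdeal`), it raises orders by one
(`fieldDer_mem`). So u = g - t e still satisfies ξ(u) + B u ≡ e. Iterating, ξ^n u ≡ P_n u, plus e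
when n = 1, where P_0 = 1 and P_n has entries in 𝔪 for n ≥ 1 (`iterate_fieldDer_sub_mem`). The
Taylor expansion in time (`IsUniformFlow.pullback_timeMap_sub_mem`) then gives u ∘ Φ_t ≡ A (u + t e)
= A g, where A = ∑ t^n/n! P_n is a finite sum with A(0) = 1. Therefore f = (A g) ∘ Φ_t⁻¹ ≡ u = g - t
e, and f is equivalent to g through (x, y) ↦ (Φ_t(x), A(x) y) (`exists_vk1Equiv_of_matrix`).

The flow exists only for small t, so total time one is reached by finitely many steps of length 1/(N
+ 1). The data ξ, B, e stay the same throughout, because they only require the current germ to agree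
with h up to order k + 1.

Orders of vanishing are measured by the estimate O(‖x‖^n), which treats the real and the holomorphic
case alike. -/

noncomputable section

namespace VK

open Asymptotics

/-! ### Taylor expansions, orders of vanishing and the inverse function theorem -/

section

variable {𝕜 : Type*} [RCLike 𝕜] {E F : Type*} [NormedAddCommGroup E] [NormedSpace 𝕜 E]
  [NormedAddCommGroup F] [NormedSpace 𝕜 F]

/-- Taylor's inequality for a chain of successive derivatives along a scalar variable. -/
theorem norm_sub_taylor_sum_le {K : ℕ} {R C : ℝ} {u : ℕ → 𝕜 → F}
    (hu : ∀ n < K, ∀ s ∈ Metric.closedBall (0 : 𝕜) R, HasDerivAt (u n) (u (n + 1) s) s)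
    (hC : ∀ s ∈ Metric.closedBall (0 : 𝕜) R, ‖u K s‖ ≤ C) :
    ∀ s ∈ Metric.closedBall (0 : 𝕜) R,
      ‖u 0 s - ∑ n ∈ Finset.range K, (s ^ n * (n.factorial : 𝕜)⁻¹) • u n 0‖ ≤ C * R ^ K := by
  induction K generalizing u with
  | zero => simpa using hC
  | succ K ih =>
    intro s hs
    have hR : 0 ≤ R := (norm_nonneg s).trans (by simpa using hs)
    have hC0 : 0 ≤ C := (norm_nonneg _).trans (hC s hs)
    -- The shifted chain bounds the derivative of the remainder; the mean value inequality on the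
    -- ball then contributes the last factor R.
    have ih' := ih (u := fun n => u (n + 1)) (fun n hn => hu (n + 1) (by omega)) hC
    have hder : ∀ x ∈ Metric.closedBall (0 : 𝕜) R, HasDerivWithinAt
        (fun s => u 0 s - ∑ n ∈ Finset.range (K + 1), (s ^ n * (n.factorial : 𝕜)⁻¹) • u n 0)
        (u 1 x - ∑ n ∈ Finset.range K, (x ^ n * (n.factorial : 𝕜)⁻¹) • u (n + 1) 0)
        (Metric.closedBall (0 : 𝕜) R) x := by
      intro x hx
      refine ((hu 0 (by omega) x hx).sub ?_).hasDerivWithinAt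
      simp only [Finset.sum_range_succ']
      simp only [pow_zero, Nat.factorial_zero, Nat.cast_one, inv_one, mul_one, one_smul]
      refine HasDerivAt.add_const (c := u 0 0) (HasDerivAt.fun_sum fun n _ => ?_)
      have h1 : HasDerivAt (fun s : 𝕜 => s ^ (n + 1) * ((n + 1).factorial : 𝕜)⁻¹)
          (x ^ n * (n.factorial : 𝕜)⁻¹) x := by
        have := (hasDerivAt_pow (n + 1) x).mul_const ((n + 1).factorial : 𝕜)⁻¹
        refine this.congr_deriv ?_
        have : (n.factorial : 𝕜) ≠ 0 := by exact_mod_cast n.factorial_ne_zero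
        have : ((n : 𝕜) + 1) ≠ 0 := by exact_mod_cast n.succ_ne_zero
        rw [Nat.factorial_succ]
        push_cast
        field_simp
      exact h1.smul_const _
    have := Convex.norm_image_sub_le_of_norm_hasDerivWithin_le hder ih'
      (convex_closedBall 0 R) (Metric.mem_closedBall_self hR) hs
    have h0 : u 0 0 - ∑ n ∈ Finset.range (K + 1), ((0 : 𝕜) ^ n * (n.factorial : 𝕜)⁻¹) • u n 0
        = 0 := by
      simp [Finset.sum_range_succ']
    rw [h0, sub_zero, sub_zero] at this
    refine this.trans ?_
    rw [pow_succ, ← mul_assoc]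
    exact mul_le_mul_of_nonneg_left (by simpa using hs) (by positivity)

/-- The Taylor sum of `f` at `0`, made of the terms of degree `< n`. -/
def taylorSum (𝕜 : Type*) [RCLike 𝕜] {E F : Type*} [NormedAddCommGroup E] [NormedSpace 𝕜 E]
    [NormedAddCommGroup F] [NormedSpace 𝕜 F] (n : ℕ) (f : E → F) (x : E) : F :=
  ∑ j ∈ Finset.range n, ((j.factorial : 𝕜)⁻¹) • iteratedFDeriv 𝕜 j f 0 (fun _ => x)

theorem hasDerivAt_iteratedFDeriv_smul {f : E → F} {x : E} {s : 𝕜} (n : ℕ)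
    (hf : ContDiffAt 𝕜 ∞ f (s • x)) :
    HasDerivAt (fun s : 𝕜 => iteratedFDeriv 𝕜 n f (s • x) (fun _ => x))
      (iteratedFDeriv 𝕜 (n + 1) f (s • x) (fun _ => x)) s := by
  have h1 : DifferentiableAt 𝕜 (iteratedFDeriv 𝕜 n f) (s • x) :=
    hf.differentiableAt_iteratedFDeriv (by exact_mod_cast WithTop.coe_lt_top _)
  have h2 : HasDerivAt (fun s : 𝕜 => s • x) x s := by
    simpa using (hasDerivAt_id s).smul_const x
  have h3 := h1.hasFDerivAt.comp_hasDerivAt s h2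
  have h4 := (ContinuousMultilinearMap.apply 𝕜 (fun _ : Fin n => E) F
    (fun _ => x)).hasFDerivAt.comp_hasDerivAt s h3
  exact h4

/-- Taylor's theorem for maps that are smooth near `0`. -/
theorem SmoothNear.sub_taylorSum_isBigO {f : E → F} (hf : SmoothNear 𝕜 f 0) (n : ℕ) :
    (fun x => f x - taylorSum 𝕜 n f x) =O[𝓝 0] fun x => ‖x‖ ^ n := by
  have hc : ContinuousAt (iteratedFDeriv 𝕜 n f) 0 :=
    (hf.self_of_nhds.iteratedFDeriv_right (m := 0) (i := n)
      (by simp only [zero_add]; exact_mod_cast le_top)).continuousAt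
  obtain ⟨M, hM⟩ : ∃ M, ∀ᶠ x in 𝓝 (0 : E), ‖iteratedFDeriv 𝕜 n f x‖ ≤ M :=
    ⟨‖iteratedFDeriv 𝕜 n f 0‖ + 1, hc.norm.eventually_le_const (lt_add_one _)⟩
  obtain ⟨r, hr, hball⟩ := Metric.eventually_nhds_iff_ball.1 (hf.and hM)
  refine IsBigO.of_bound M ?_
  filter_upwards [Metric.ball_mem_nhds 0 hr] with x hx
  have hmem : ∀ s ∈ Metric.closedBall (0 : 𝕜) 1, s • x ∈ Metric.ball (0 : E) r := by
    intro s hs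
    simp only [mem_closedBall_zero_iff, mem_ball_zero_iff, norm_smul] at *
    nlinarith [norm_nonneg x, norm_nonneg s]
  have := norm_sub_taylor_sum_le (𝕜 := 𝕜) (K := n) (R := 1) (C := M * ‖x‖ ^ n)
    (u := fun n s => iteratedFDeriv 𝕜 n f (s • x) (fun _ => x))
    (fun m _ s hs => hasDerivAt_iteratedFDeriv_smul m (hball _ (hmem s hs)).1)
    (fun s hs => by
      refine (ContinuousMultilinearMap.le_opNorm _ _).trans ?_
      simp only [Finset.prod_const, Finset.card_univ, Fintype.card_fin]
      exact mul_le_mul_of_nonneg_right (hball _ (hmem s hs)).2 (by positivity))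
    1 (by simp)
  simpa [taylorSum] using this

/-- The constant coefficient is the limit at 0, hence zero; dividing by t lowers both the degree and
the order by one. The punctured filter makes the division legitimate. -/
theorem eq_zero_of_sum_smul_isBigO {N : ℕ} {c : ℕ → F}
    (h : (fun t : 𝕜 => ∑ n ∈ Finset.range N, t ^ n • c n) =O[𝓝[≠] 0] fun t => ‖t‖ ^ N) :
    ∀ n < N, c n = 0 := by
  induction N generalizing c with
  | zero => simp
  | succ N ih =>
    have h0 : c 0 = 0 := by
      have hl : Tendsto (fun t : 𝕜 => ∑ n ∈ Finset.range (N + 1), t ^ n • c n) (𝓝[≠] 0)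
          (𝓝 (∑ n ∈ Finset.range (N + 1), (0 : 𝕜) ^ n • c n)) := by
        have : Continuous fun t : 𝕜 => ∑ n ∈ Finset.range (N + 1), t ^ n • c n := by fun_prop
        exact (this.tendsto 0).mono_left nhdsWithin_le_nhds
      have hl' : Tendsto (fun t : 𝕜 => ∑ n ∈ Finset.range (N + 1), t ^ n • c n) (𝓝[≠] 0)
          (𝓝 0) := by
        refine h.trans_tendsto ?_
        have : Continuous fun t : 𝕜 => ‖t‖ ^ (N + 1) := by fun_prop
        simpa using (this.tendsto 0).mono_left nhdsWithin_le_nhds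
      have := tendsto_nhds_unique hl hl'
      simpa [Finset.sum_range_succ'] using this
    have h1 : (fun t : 𝕜 => ∑ n ∈ Finset.range N, t ^ n • c (n + 1)) =O[𝓝[≠] 0]
        fun t => ‖t‖ ^ N := by
      have h2 : (fun t : 𝕜 => t⁻¹ • ∑ n ∈ Finset.range (N + 1), t ^ n • c n) =O[𝓝[≠] 0]
          fun t => ‖t‖⁻¹ * ‖t‖ ^ (N + 1) := by
        refine IsBigO.smul (k₁ := fun t : 𝕜 => t⁻¹) (IsBigO.of_norm_le fun t => by simp) h
      refine h2.congr' ?_ ?_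
      · filter_upwards [self_mem_nhdsWithin] with t ht
        have ht : t ≠ 0 := ht
        rw [Finset.sum_range_succ', h0, smul_zero, add_zero, Finset.smul_sum]
        refine Finset.sum_congr rfl fun n _ => ?_
        rw [smul_smul, pow_succ', inv_mul_cancel_left₀ ht]
      · filter_upwards [self_mem_nhdsWithin] with t ht
        have ht : ‖t‖ ≠ 0 := norm_ne_zero_iff.2 ht
        rw [pow_succ', inv_mul_cancel_left₀ ht]
    intro n hn
    cases n with
    | zero => exact h0
    | succ n => exact ih h1 n (by omega)

theorem iteratedFDeriv_diag_smul (j : ℕ) (f : E → F) (t : 𝕜) (x : E) :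
    iteratedFDeriv 𝕜 j f 0 (fun _ => t • x) = t ^ j • iteratedFDeriv 𝕜 j f 0 (fun _ => x) := by
  have := (iteratedFDeriv 𝕜 j f 0).map_smul_univ (fun _ => t) (fun _ => x)
  simpa using this

/-- A sum of homogeneous terms of degree `< N` that approximates `f` to order `N` is its Taylor
sum. -/
theorem SmoothNear.taylorSum_eq {f : E → F} (hf : SmoothNear 𝕜 f 0) {N : ℕ} {c : ℕ → E → F}
    (hc : ∀ n < N, ∀ (t : 𝕜) x, c n (t • x) = t ^ n • c n x)
    (h : (fun x => f x - ∑ n ∈ Finset.range N, c n x) =O[𝓝 0] fun x => ‖x‖ ^ N) (n : ℕ)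
    (hn : n < N) (x : E) :
    ((n.factorial : 𝕜)⁻¹) • iteratedFDeriv 𝕜 n f 0 (fun _ => x) = c n x := by
  have h1 := h.sub (hf.sub_taylorSum_isBigO N)
  have ht : Tendsto (fun t : 𝕜 => t • x) (𝓝[≠] 0) (𝓝 0) := by
    have : Continuous fun t : 𝕜 => t • x := by fun_prop
    simpa using (this.tendsto 0).mono_left nhdsWithin_le_nhds
  have h2 : (fun t : 𝕜 => ∑ n ∈ Finset.range N, t ^ n •
      (((n.factorial : 𝕜)⁻¹) • iteratedFDeriv 𝕜 n f 0 (fun _ => x) - c n x)) =O[𝓝[≠] 0]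
      fun t => ‖t‖ ^ N := by
    refine ((h1.comp_tendsto ht).congr_left (fun t => ?_)).trans
      (IsBigO.of_bound (‖x‖ ^ N) (Eventually.of_forall fun t => ?_))
    · simp only [Function.comp_apply, sub_sub_sub_cancel_left, taylorSum, smul_sub,
        Finset.sum_sub_distrib]
      congr 1
      · refine Finset.sum_congr rfl fun n _ => ?_
        rw [iteratedFDeriv_diag_smul, smul_comm]
      · exact Finset.sum_congr rfl fun n hn => hc n (Finset.mem_range.1 hn) t x
    · simp only [Function.comp_apply, norm_smul, mul_pow, norm_mul, norm_pow, norm_norm]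
      rw [mul_comm]
  exact sub_eq_zero.1 (eq_zero_of_sum_smul_isBigO h2 n hn)

theorem SmoothNear.fderiv {f : E → F} (hf : SmoothNear 𝕜 f 0) :
    SmoothNear 𝕜 (_root_.fderiv 𝕜 f) 0 :=
  hf.mono fun _ hx => hx.fderiv_right (m := ∞) le_rfl

/-- Differentiation lowers the order of vanishing of a smooth map by at most one. -/
theorem SmoothNear.fderiv_isBigO {f : E → F} (hf : SmoothNear 𝕜 f 0) {n : ℕ}
    (h : f =O[𝓝 0] fun x => ‖x‖ ^ (n + 1)) :
    _root_.fderiv 𝕜 f =O[𝓝 0] fun x => ‖x‖ ^ n := by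
  set Q : ℕ → E → (E →L[𝕜] F) := fun j x =>
    ((j.factorial : 𝕜)⁻¹) • iteratedFDeriv 𝕜 j (_root_.fderiv 𝕜 f) 0 (fun _ => x) with hQ
  have hQs : ∀ j (t : 𝕜) x, Q j (t • x) = t ^ j • Q j x := fun j t x => by
    simp only [hQ, iteratedFDeriv_diag_smul]
    rw [smul_comm]
  -- If the Taylor terms of f' below degree m vanish, the rescaled maps f(tx)/t^(m+1) have
  -- derivatives f'(tx)/t^m that converge to Q m uniformly on the unit ball. The maps themselves
  -- tend to 0 because m < n, so Q m is the derivative of the zero function.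
  have key : ∀ j < n, ∀ x, Q j x = 0 := by
    intro m
    induction m using Nat.strong_induction_on with
    | _ m ih =>
    intro hm
    have hT : (fun x => _root_.fderiv 𝕜 f x - Q m x) =O[𝓝 0] fun x => ‖x‖ ^ (m + 1) := by
      refine (hf.fderiv.sub_taylorSum_isBigO (m + 1)).congr_left fun x => ?_
      rw [taylorSum, Finset.sum_range_succ, Finset.sum_eq_zero, zero_add]
      intro j hj
      exact ih j (Finset.mem_range.1 hj) ((Finset.mem_range.1 hj).trans hm) x
    obtain ⟨C, hC0, hC⟩ := hT.exists_pos
    obtain ⟨D, hD0, hD⟩ := h.exists_pos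
    obtain ⟨r, hr, hb⟩ := Metric.eventually_nhds_iff_ball.1 ((hf.and hC.bound).and hD.bound)
    have hmem : ∀ᶠ t : 𝕜 in 𝓝[≠] 0, ∀ x ∈ Metric.ball (0 : E) 1, t • x ∈ Metric.ball (0 : E) r := by
      filter_upwards [nhdsWithin_le_nhds (Metric.ball_mem_nhds (0 : 𝕜) hr)] with t ht x hx
      simp only [mem_ball_zero_iff, norm_smul] at *
      nlinarith [norm_nonneg t, norm_nonneg x]
    have hzero : ∀ x ∈ Metric.ball (0 : E) 1, Q m x = 0 := by
      intro x hx
      have hball : Metric.ball (0 : E) 1 ∈ 𝓝 x := Metric.isOpen_ball.mem_nhds hx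
      have := hasFDerivAt_of_tendstoUniformlyOnFilter (𝕜 := 𝕜) (x := x) (l := 𝓝[≠] (0 : 𝕜))
        (f := fun t x => (t ^ (m + 1))⁻¹ • f (t • x))
        (f' := fun t x => (t ^ m)⁻¹ • _root_.fderiv 𝕜 f (t • x))
        (g := fun _ => (0 : F)) (g' := Q m) ?_ ?_ ?_
      · exact this.unique (hasFDerivAt_const 0 x)
      · refine TendstoUniformlyOnFilter.mono_right
          (tendstoUniformlyOn_iff_tendstoUniformlyOnFilter.1 ?_) (le_principal_iff.2 hball)
        rw [Metric.tendstoUniformlyOn_iff]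
        intro ε hε
        have hε' : 0 < ε / C := by positivity
        filter_upwards [hmem, self_mem_nhdsWithin,
          nhdsWithin_le_nhds (Metric.ball_mem_nhds (0 : 𝕜) hε')] with t ht ht0 htε x hx
        have ht0 : t ≠ 0 := ht0
        have ht0' : 0 < ‖t‖ := norm_pos_iff.2 ht0
        have hb' := (hb _ (ht x hx)).1.2
        rw [dist_comm, dist_eq_norm]
        have e1 : (t ^ m)⁻¹ • _root_.fderiv 𝕜 f (t • x) - Q m x
            = (t ^ m)⁻¹ • (_root_.fderiv 𝕜 f (t • x) - Q m (t • x)) := by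
          rw [hQs, smul_sub, inv_smul_smul₀ (pow_ne_zero _ ht0)]
        rw [e1, norm_smul, norm_inv, norm_pow]
        have hx1 : ‖x‖ ≤ 1 := (mem_ball_zero_iff.1 hx).le
        have htε' : ‖t‖ < ε / C := mem_ball_zero_iff.1 htε
        calc (‖t‖ ^ m)⁻¹ * ‖_root_.fderiv 𝕜 f (t • x) - Q m (t • x)‖
            ≤ (‖t‖ ^ m)⁻¹ * (C * ‖t‖ ^ (m + 1)) := by
              refine mul_le_mul_of_nonneg_left (hb'.trans ?_) (by positivity)
              rw [norm_pow, norm_norm, norm_smul, mul_pow]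
              have : ‖x‖ ^ (m + 1) ≤ 1 := pow_le_one₀ (norm_nonneg x) hx1
              have h3 : 0 ≤ C * ‖t‖ ^ (m + 1) := by positivity
              nlinarith
          _ = C * ‖t‖ := by
              have : ‖t‖ ≠ 0 := ht0'.ne'
              rw [pow_succ]
              field_simp
          _ < C * (ε / C) := by gcongr
          _ = ε := by field_simp
      · filter_upwards [(hmem.and self_mem_nhdsWithin).prod_mk hball]
        rintro ⟨t, x⟩ ⟨⟨ht, ht0⟩, hx⟩
        have ht0 : t ≠ 0 := ht0
        have hd : HasFDerivAt f (_root_.fderiv 𝕜 f (t • x)) (t • x) :=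
          ((hb _ (ht x hx)).1.1.differentiableAt (by simp)).hasFDerivAt
        have h2 : HasFDerivAt (fun x : E => t • x) (t • ContinuousLinearMap.id 𝕜 E) x :=
          (hasFDerivAt_id x).const_smul t
        have h3 := (hd.comp x h2).const_smul (t ^ (m + 1))⁻¹
        refine h3.congr_fderiv ?_
        ext v
        simp only [smul_apply, ContinuousLinearMap.comp_apply,
          ContinuousLinearMap.id_apply, map_smul, smul_smul]
        congr 1
        field_simp
        rw [pow_succ']
      · filter_upwards [hball] with x hx
        rw [tendsto_zero_iff_norm_tendsto_zero]
        have hlim : Tendsto (fun t : 𝕜 => D * ‖t‖ ^ (n - m)) (𝓝[≠] 0) (𝓝 0) := by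
          have : Continuous fun t : 𝕜 => D * ‖t‖ ^ (n - m) := by fun_prop
          have := (this.tendsto 0).mono_left (nhdsWithin_le_nhds (s := {0}ᶜ))
          rwa [norm_zero, zero_pow (by omega), mul_zero] at this
        refine squeeze_zero' (Eventually.of_forall fun _ => norm_nonneg _) ?_ hlim
        filter_upwards [hmem, self_mem_nhdsWithin] with t ht ht0
        have ht0 : t ≠ 0 := ht0
        have ht0' : 0 < ‖t‖ := norm_pos_iff.2 ht0
        have hb' := (hb _ (ht x hx)).2
        have hx1 : ‖x‖ ≤ 1 := (mem_ball_zero_iff.1 hx).le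
        rw [norm_smul, norm_inv, norm_pow]
        calc (‖t‖ ^ (m + 1))⁻¹ * ‖f (t • x)‖ ≤ (‖t‖ ^ (m + 1))⁻¹ * (D * ‖t‖ ^ (n + 1)) := by
              refine mul_le_mul_of_nonneg_left (hb'.trans ?_) (by positivity)
              rw [norm_pow, norm_norm, norm_smul, mul_pow]
              have : ‖x‖ ^ (n + 1) ≤ 1 := pow_le_one₀ (norm_nonneg x) hx1
              have h3 : 0 ≤ D * ‖t‖ ^ (n + 1) := by positivity
              nlinarith
          _ = D * ‖t‖ ^ (n - m) := by
              obtain ⟨d, rfl⟩ := Nat.exists_eq_add_of_lt hm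
              have : ‖t‖ ≠ 0 := ht0'.ne'
              rw [show m + d + 1 - m = d + 1 by omega,
                show m + d + 1 + 1 = (m + 1) + (d + 1) by omega, pow_add _ (m + 1)]
              field_simp
    intro x
    -- Homogeneity carries the vanishing from the unit ball to every x.
    obtain ⟨t, ht0, ht⟩ : ∃ t : 𝕜, t ≠ 0 ∧ t • x ∈ Metric.ball (0 : E) 1 := by
      have hc : Continuous fun t : 𝕜 => t • x := by fun_prop
      have : ∀ᶠ t : 𝕜 in 𝓝[≠] 0, t • x ∈ Metric.ball (0 : E) 1 := by
        refine ((hc.tendsto 0).mono_left nhdsWithin_le_nhds).eventually ?_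
        rw [zero_smul]
        exact Metric.ball_mem_nhds (0 : E) one_pos
      obtain ⟨t, h1, h2⟩ := (this.and self_mem_nhdsWithin).exists
      exact ⟨t, h2, h1⟩
    have := hzero _ ht
    rw [hQs] at this
    exact (smul_eq_zero.1 this).resolve_left (pow_ne_zero _ ht0)
  refine (hf.fderiv.sub_taylorSum_isBigO n).congr_left fun x => ?_
  rw [taylorSum, Finset.sum_eq_zero, sub_zero]
  intro j hj
  exact key j (Finset.mem_range.1 hj) x

/-- The inverse function theorem for germs with derivative the identity. -/
theorem isDiffeoGerm_of_hasFDerivAt_id [CompleteSpace E] {Ψ : E → E} (h0 : Ψ 0 = 0)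
    (hs : SmoothNear 𝕜 Ψ 0) (hd : HasFDerivAt Ψ (ContinuousLinearMap.id 𝕜 E) 0) :
    IsDiffeoGerm 𝕜 Ψ := by
  have hd' : HasFDerivAt Ψ ((ContinuousLinearEquiv.refl 𝕜 E : E ≃L[𝕜] E) : E →L[𝕜] E) 0 := hd
  have hs0 := hs.self_of_nhds
  set e := hs0.toOpenPartialHomeomorph Ψ hd' (by simp) with he
  have hsrc : (0 : E) ∈ e.source := hs0.mem_toOpenPartialHomeomorph_source hd' (by simp)
  have htgt : (0 : E) ∈ e.target := by
    simpa [h0] using hs0.image_mem_toOpenPartialHomeomorph_target hd' (by simp)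
  have hcoe : ∀ x, e x = Ψ x := fun x => rfl
  have hsymm0 : e.symm 0 = 0 := by
    have := e.left_inv hsrc
    rwa [hcoe, h0] at this
  have hcont : Tendsto e.symm (𝓝 0) (𝓝 0) := by
    have := e.symm.continuousAt (x := 0) htgt
    rwa [ContinuousAt, hsymm0] at this
  refine ⟨h0, hs, e.symm, hsymm0, ?_, ?_, ?_⟩
  -- Invertibility of the derivative is an open condition; it is needed at all points near 0, since
  -- the inverse must be smooth on a neighbourhood.
  · have hinv : ∀ᶠ x in 𝓝 (0 : E), ∃ f' : E ≃L[𝕜] E, (f' : E →L[𝕜] E) = fderiv 𝕜 Ψ x := by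
      have hc : ContinuousAt (fderiv 𝕜 Ψ) 0 :=
        (hs0.fderiv_right (m := 0) (by simp)).continuousAt
      have := hc.eventually (p := fun T => ∃ f' : E ≃L[𝕜] E, (f' : E →L[𝕜] E) = T) (by
        rw [hd'.fderiv]
        exact ContinuousLinearEquiv.nhds _)
      exact this
    filter_upwards [hcont.eventually hs, hcont.eventually hinv, e.open_target.mem_nhds htgt]
      with y h1 ⟨f', hf'⟩ h3
    refine e.contDiffAt_symm (f₀' := f') h3 ?_ h1
    rw [hf']
    exact (h1.differentiableAt (by simp)).hasFDerivAt
  · filter_upwards [e.open_source.mem_nhds hsrc] with z hz using e.left_inv hz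
  · filter_upwards [e.open_target.mem_nhds htgt] with z hz using e.right_inv hz

end

/-! ### Function germs and the filtration by order of vanishing -/

section

variable {𝕜 : Type*} [RCLike 𝕜] {p q : ℕ}

theorem Ep.exists_rep (φ : Ep 𝕜 p) : ∃ f, ∃ hf : SmoothNear 𝕜 f 0, φ = Ep.mk f hf := by
  obtain ⟨_, f, hf, rfl⟩ := φ
  exact ⟨f, hf, rfl⟩

theorem Ep.mk_eq_mk {f g : (Fin p → 𝕜) → 𝕜} {hf : SmoothNear 𝕜 f 0} {hg : SmoothNear 𝕜 g 0} :
    Ep.mk f hf = Ep.mk g hg ↔ f =ᶠ[𝓝 0] g := by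
  exact Subtype.ext_iff.trans Germ.coe_eq

theorem Ep.mk_congr {f g : (Fin p → 𝕜) → 𝕜} {hf : SmoothNear 𝕜 f 0} (hg : SmoothNear 𝕜 g 0)
    (h : ∀ x, f x = g x) : Ep.mk f hf = Ep.mk g hg :=
  Ep.mk_eq_mk.2 (Eventually.of_forall h)

theorem SmoothNear.fun_add {E F : Type*} [NormedAddCommGroup E] [NormedSpace 𝕜 E]
    [NormedAddCommGroup F] [NormedSpace 𝕜 F] {f g : E → F} {a : E}
    (hf : SmoothNear 𝕜 f a) (hg : SmoothNear 𝕜 g a) : SmoothNear 𝕜 (fun x => f x + g x) a := by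
  filter_upwards [hf, hg] with x h1 h2 using h1.add h2

theorem SmoothNear.fun_sub {E F : Type*} [NormedAddCommGroup E] [NormedSpace 𝕜 E]
    [NormedAddCommGroup F] [NormedSpace 𝕜 F] {f g : E → F} {a : E}
    (hf : SmoothNear 𝕜 f a) (hg : SmoothNear 𝕜 g a) : SmoothNear 𝕜 (fun x => f x - g x) a := by
  filter_upwards [hf, hg] with x h1 h2 using h1.sub h2

theorem SmoothNear.fun_mul {E : Type*} [NormedAddCommGroup E] [NormedSpace 𝕜 E]
    {f g : E → 𝕜} {a : E}
    (hf : SmoothNear 𝕜 f a) (hg : SmoothNear 𝕜 g a) : SmoothNear 𝕜 (fun x => f x * g x) a := by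
  filter_upwards [hf, hg] with x h1 h2 using h1.mul h2

theorem SmoothNear.fun_sum {ι E F : Type*} [NormedAddCommGroup E] [NormedSpace 𝕜 E]
    [NormedAddCommGroup F] [NormedSpace 𝕜 F] {s : Finset ι} {f : ι → E → F} {a : E}
    (hf : ∀ i, SmoothNear 𝕜 (f i) a) : SmoothNear 𝕜 (fun x => ∑ i ∈ s, f i x) a := by
  induction s using Finset.cons_induction with
  | empty => exact Eventually.of_forall fun _ => by simpa using contDiffAt_const
  | cons i s hi ih => simpa only [Finset.sum_cons] using (hf i).fun_add ih

theorem SmoothNear.comp {E F G : Type*} [NormedAddCommGroup E] [NormedSpace 𝕜 E]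
    [NormedAddCommGroup F] [NormedSpace 𝕜 F] [NormedAddCommGroup G] [NormedSpace 𝕜 G]
    {g : F → G} {f : E → F} {a : E} {b : F} (hg : SmoothNear 𝕜 g b) (hf : SmoothNear 𝕜 f a)
    (hb : f a = b) : SmoothNear 𝕜 (fun x => g (f x)) a := by
  subst hb
  filter_upwards [hf, hf.self_of_nhds.continuousAt.eventually hg] with x h1 h2
  exact h2.comp x h1

theorem ContDiff.smoothNear {E F : Type*} [NormedAddCommGroup E] [NormedSpace 𝕜 E]
    [NormedAddCommGroup F] [NormedSpace 𝕜 F] {f : E → F} {a : E} (hf : ContDiff 𝕜 ∞ f) :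
    SmoothNear 𝕜 f a :=
  Eventually.of_forall fun _ => hf.contDiffAt

theorem smoothNear_const {E F : Type*} [NormedAddCommGroup E] [NormedSpace 𝕜 E]
    [NormedAddCommGroup F] [NormedSpace 𝕜 F] {a : E} (c : F) :
    SmoothNear 𝕜 (fun _ : E => c) a :=
  Eventually.of_forall fun _ => contDiffAt_const

theorem SmoothNear.fderiv_apply {E F : Type*} [NormedAddCommGroup E] [NormedSpace 𝕜 E]
    [NormedAddCommGroup F] [NormedSpace 𝕜 F] {f : E → F} (hf : SmoothNear 𝕜 f 0) (v : E) :
    SmoothNear 𝕜 (fun x => _root_.fderiv 𝕜 f x v) 0 :=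
  Eventually.mono hf.fderiv fun _ h => h.clm_apply contDiffAt_const

theorem Ep.mk_add {f g : (Fin p → 𝕜) → 𝕜} (hf : SmoothNear 𝕜 f 0) (hg : SmoothNear 𝕜 g 0) :
    Ep.mk f hf + Ep.mk g hg = Ep.mk (fun x => f x + g x) (hf.fun_add hg) := rfl

theorem Ep.mk_sub {f g : (Fin p → 𝕜) → 𝕜} (hf : SmoothNear 𝕜 f 0) (hg : SmoothNear 𝕜 g 0) :
    Ep.mk f hf - Ep.mk g hg = Ep.mk (fun x => f x - g x) (hf.fun_sub hg) := rfl

theorem Ep.mk_mul {f g : (Fin p → 𝕜) → 𝕜} (hf : SmoothNear 𝕜 f 0) (hg : SmoothNear 𝕜 g 0) :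
    Ep.mk f hf * Ep.mk g hg = Ep.mk (fun x => f x * g x) (hf.fun_mul hg) := rfl

theorem Ep.mk_sum {ι : Type*} {s : Finset ι} {f : ι → (Fin p → 𝕜) → 𝕜}
    (hf : ∀ i, SmoothNear 𝕜 (f i) 0) :
    ∑ i ∈ s, Ep.mk (f i) (hf i) = Ep.mk (fun x => ∑ i ∈ s, f i x) (.fun_sum hf) := by
  induction s using Finset.cons_induction with
  | empty => exact Ep.mk_congr (hf := (smoothNear_const _)) _ fun x => by simp
  | cons i s hi ih =>
    rw [Finset.sum_cons, ih, Ep.mk_add]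
    exact Ep.mk_congr _ fun x => by simp

theorem Ep.mk_prod {ι : Type*} (s : Finset ι) (f : ι → (Fin p → 𝕜) → 𝕜)
    (hf : ∀ i, SmoothNear 𝕜 (f i) 0) (hp : SmoothNear 𝕜 (fun x => ∏ i ∈ s, f i x) 0) :
    ∏ i ∈ s, Ep.mk (f i) (hf i) = Ep.mk (fun x => ∏ i ∈ s, f i x) hp := by
  have h : ∀ s : Finset ι, ∃ hp : SmoothNear 𝕜 (fun x => ∏ i ∈ s, f i x) 0,
      ∏ i ∈ s, Ep.mk (f i) (hf i) = Ep.mk (fun x => ∏ i ∈ s, f i x) hp := by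
    intro s
    induction s using Finset.cons_induction with
    | empty =>
      refine ⟨by simpa using smoothNear_const (1 : 𝕜), ?_⟩
      exact Ep.mk_congr (hf := (smoothNear_const _)) _ fun x => by simp
    | cons i s hi ih =>
      obtain ⟨h1, h2⟩ := ih
      refine ⟨by simpa only [Finset.prod_cons] using (hf i).fun_mul h1, ?_⟩
      rw [Finset.prod_cons, h2, Ep.mk_mul]
      exact Ep.mk_congr _ fun x => by simp
  obtain ⟨h1, h2⟩ := h s
  exact h2

/-- The constant germs. -/
def Ep.const : 𝕜 →+* Ep 𝕜 p where
  toFun c := Ep.mk (fun _ => c) (smoothNear_const _)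
  map_one' := rfl
  map_zero' := rfl
  map_mul' _ _ := rfl
  map_add' _ _ := rfl

/-- The coordinate germs. -/
def Ep.coord (i : Fin p) : Ep 𝕜 p :=
  Ep.mk (fun x => x i) (ContDiff.smoothNear (contDiff_apply 𝕜 𝕜 i))

theorem mk_mem_maxIdeal {f : (Fin p → 𝕜) → 𝕜} {hf : SmoothNear 𝕜 f 0} :
    Ep.mk f hf ∈ maxIdeal 𝕜 p ↔ f 0 = 0 :=
  Iff.rfl

/-- The ideal of germs that are `O(‖x‖ ^ n)`. -/
def vanishIdeal (𝕜 : Type*) [RCLike 𝕜] (p n : ℕ) : Ideal (Ep 𝕜 p) where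
  carrier := {φ | ∃ f, ∃ hf : SmoothNear 𝕜 f 0, φ = Ep.mk f hf ∧ f =O[𝓝 0] fun x => ‖x‖ ^ n}
  add_mem' := by
    rintro _ _ ⟨f, hf, rfl, h1⟩ ⟨g, hg, rfl, h2⟩
    exact ⟨_, _, Ep.mk_add hf hg, h1.add h2⟩
  zero_mem' := ⟨fun _ => 0, (smoothNear_const _), rfl, isBigO_zero _ _⟩
  smul_mem' := by
    rintro c _ ⟨g, hg, rfl, h2⟩
    obtain ⟨f, hf, rfl⟩ := c.exists_rep
    refine ⟨_, _, Ep.mk_mul hf hg, ?_⟩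
    have h1 : f =O[𝓝 0] fun _ => (1 : ℝ) := hf.self_of_nhds.continuousAt.isBigO_one ℝ
    simpa using h1.mul h2

theorem mk_mem_vanishIdeal {f : (Fin p → 𝕜) → 𝕜} {hf : SmoothNear 𝕜 f 0} {n : ℕ} :
    Ep.mk f hf ∈ vanishIdeal 𝕜 p n ↔ f =O[𝓝 0] fun x => ‖x‖ ^ n := by
  constructor
  · rintro ⟨g, hg, h, h1⟩
    exact h1.congr' (Ep.mk_eq_mk.1 h).symm EventuallyEq.rfl
  · exact fun h => ⟨f, hf, rfl, h⟩

theorem vanishIdeal_anti {m n : ℕ} (h : m ≤ n) : vanishIdeal 𝕜 p n ≤ vanishIdeal 𝕜 p m := by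
  rintro _ ⟨f, hf, rfl, h1⟩
  refine mk_mem_vanishIdeal.2 (h1.trans (IsBigO.of_bound 1 ?_))
  filter_upwards [Metric.ball_mem_nhds (0 : Fin p → 𝕜) one_pos] with x hx
  have : ‖x‖ ≤ 1 := (mem_ball_zero_iff.1 hx).le
  simpa using pow_le_pow_of_le_one (norm_nonneg x) this h

theorem mul_mem_vanishIdeal {m n : ℕ} {a b : Ep 𝕜 p} (ha : a ∈ vanishIdeal 𝕜 p m)
    (hb : b ∈ vanishIdeal 𝕜 p n) : a * b ∈ vanishIdeal 𝕜 p (m + n) := by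
  obtain ⟨f, hf, rfl, h1⟩ := ha
  obtain ⟨g, hg, rfl, h2⟩ := hb
  rw [Ep.mk_mul, mk_mem_vanishIdeal]
  simpa only [pow_add] using h1.mul h2

theorem mem_vanishIdeal_zero (a : Ep 𝕜 p) : a ∈ vanishIdeal 𝕜 p 0 := by
  obtain ⟨f, hf, rfl⟩ := a.exists_rep
  rw [mk_mem_vanishIdeal]
  simpa using hf.self_of_nhds.continuousAt.isBigO_one ℝ

theorem vanishIdeal_one : vanishIdeal 𝕜 p 1 = maxIdeal 𝕜 p := by
  ext a
  obtain ⟨f, hf, rfl⟩ := a.exists_rep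
  rw [mk_mem_vanishIdeal, mk_mem_maxIdeal]
  constructor
  · intro h
    exact IsBigO.eq_zero_of_norm_pow (x₀ := 0) (n := 1) (by simpa using h) one_ne_zero
  · intro h
    simpa [taylorSum, h] using hf.sub_taylorSum_isBigO 1

/-- For n ≥ 2 this inclusion suffices: the germs that have to be placed in a power of 𝔪 are
homogeneous forms, which `mk_diag_mem` treats directly. -/
theorem maxIdeal_pow_le (n : ℕ) : maxIdeal 𝕜 p ^ n ≤ vanishIdeal 𝕜 p n := by
  induction n with
  | zero => exact fun a _ => mem_vanishIdeal_zero a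
  | succ n ih =>
    rw [pow_succ, Ideal.mul_le]
    intro a ha b hb
    rw [← vanishIdeal_one] at hb
    exact mul_mem_vanishIdeal (ih ha) hb

theorem pderiv_mk (i : Fin p) {f : (Fin p → 𝕜) → 𝕜} (hf : SmoothNear 𝕜 f 0) :
    pderiv i (Ep.mk f hf) = Ep.mk (fun x => fderiv 𝕜 f x (Pi.single i 1))
      (hf.fderiv_apply _) := rfl

theorem pderiv_add (i : Fin p) (a b : Ep 𝕜 p) : pderiv i (a + b) = pderiv i a + pderiv i b := by
  obtain ⟨f, hf, rfl⟩ := a.exists_rep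
  obtain ⟨g, hg, rfl⟩ := b.exists_rep
  rw [Ep.mk_add, pderiv_mk, pderiv_mk, pderiv_mk, Ep.mk_add, Ep.mk_eq_mk]
  filter_upwards [hf, hg] with x h1 h2
  rw [fderiv_fun_add (h1.differentiableAt (by simp)) (h2.differentiableAt (by simp))]
  rfl

theorem pderiv_mul (i : Fin p) (a b : Ep 𝕜 p) :
    pderiv i (a * b) = a * pderiv i b + b * pderiv i a := by
  obtain ⟨f, hf, rfl⟩ := a.exists_rep
  obtain ⟨g, hg, rfl⟩ := b.exists_rep
  rw [Ep.mk_mul, pderiv_mk, pderiv_mk, pderiv_mk, Ep.mk_mul, Ep.mk_mul, Ep.mk_add, Ep.mk_eq_mk]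
  filter_upwards [hf, hg] with x h1 h2
  rw [fderiv_fun_mul (h1.differentiableAt (by simp)) (h2.differentiableAt (by simp))]
  rfl

theorem pderiv_mem_vanishIdeal (i : Fin p) {a : Ep 𝕜 p} {n : ℕ}
    (ha : a ∈ vanishIdeal 𝕜 p (n + 1)) : pderiv i a ∈ vanishIdeal 𝕜 p n := by
  obtain ⟨f, hf, rfl, h1⟩ := ha
  rw [pderiv_mk, mk_mem_vanishIdeal]
  refine IsBigO.trans ?_ (hf.fderiv_isBigO h1)
  refine IsBigO.of_bound ‖(Pi.single i 1 : Fin p → 𝕜)‖ (Eventually.of_forall fun x => ?_)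
  rw [mul_comm]
  exact (fderiv 𝕜 f x).le_opNorm _

/-- The derivation of `ℰ_p` given by a vector field germ. -/
def fieldDer (ξ : Fin p → Ep 𝕜 p) : Derivation ℤ (Ep 𝕜 p) (Ep 𝕜 p) :=
  Derivation.mk' (AddMonoidHom.mk' (fun a => ∑ i, ξ i * pderiv i a) (fun a b => by
    simp only [pderiv_add, mul_add, Finset.sum_add_distrib])).toIntLinearMap (fun a b => by
    simp only [AddMonoidHom.coe_toIntLinearMap, AddMonoidHom.mk'_apply, pderiv_mul, smul_eq_mul,
      Finset.mul_sum, ← Finset.sum_add_distrib]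
    exact Finset.sum_congr rfl fun i _ => by ring)

theorem fieldDer_apply (ξ : Fin p → Ep 𝕜 p) (a : Ep 𝕜 p) :
    fieldDer ξ a = ∑ i, ξ i * pderiv i a := rfl

/-- The coefficients of ξ contribute order two and differentiation loses at most one. For n = 0 the
coefficients alone suffice. -/
theorem fieldDer_mem {ξ : Fin p → Ep 𝕜 p} (hξ : ∀ i, ξ i ∈ vanishIdeal 𝕜 p 2) {a : Ep 𝕜 p} {n : ℕ}
    (ha : a ∈ vanishIdeal 𝕜 p n) : fieldDer ξ a ∈ vanishIdeal 𝕜 p (n + 1) := by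
  rw [fieldDer_apply]
  refine Ideal.sum_mem _ fun i _ => ?_
  cases n with
  | zero => exact vanishIdeal_anti (by omega) (Ideal.mul_mem_right _ _ (hξ i))
  | succ n =>
    have := mul_mem_vanishIdeal (hξ i) (pderiv_mem_vanishIdeal i ha)
    rwa [show 2 + n = n + 1 + 1 by omega] at this

theorem fieldDer_iterate_mem {ξ : Fin p → Ep 𝕜 p} (hξ : ∀ i, ξ i ∈ vanishIdeal 𝕜 p 2)
    {a : Ep 𝕜 p} {n : ℕ} (ha : a ∈ vanishIdeal 𝕜 p n) (m : ℕ) :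
    (fieldDer ξ)^[m] a ∈ vanishIdeal 𝕜 p (n + m) := by
  induction m with
  | zero => exact ha
  | succ m ih =>
    rw [Function.iterate_succ_apply']
    exact fieldDer_mem hξ ih

theorem pullback_mk (h : MapGerm 𝕜 p q) {f : (Fin q → 𝕜) → 𝕜} (hf : SmoothNear 𝕜 f 0) :
    h.pullback (Ep.mk f hf) = Ep.mk (fun x => f (h.toFun x)) (hf.comp h.smooth' h.map_zero') :=
  rfl

theorem MapGerm.isBigO (h : MapGerm 𝕜 p q) : h.toFun =O[𝓝 0] fun x => ‖x‖ := by
  simpa [taylorSum, h.map_zero'] using h.smooth'.sub_taylorSum_isBigO 1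

theorem pullback_mem_vanishIdeal (h : MapGerm 𝕜 p q) {a : Ep 𝕜 q} {n : ℕ}
    (ha : a ∈ vanishIdeal 𝕜 q n) : h.pullback a ∈ vanishIdeal 𝕜 p n := by
  obtain ⟨f, hf, rfl, h1⟩ := ha
  rw [pullback_mk, mk_mem_vanishIdeal]
  exact (h1.comp_tendsto h.tendsto).trans (h.isBigO.norm_left.pow n)

/-! ### Iterating the equation ξ u + B u ≡ e -/

section ExpansionAlongField

variable (ξ : Fin p → Ep 𝕜 p) (B : Matrix (Fin q) (Fin q) (Ep 𝕜 p))

/-- The matrices `P n` with `ξ^n u = P n u` whenever `ξ u = - B u`. -/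
def iterMatrix : ℕ → Matrix (Fin q) (Fin q) (Ep 𝕜 p)
  | 0 => 1
  | n + 1 => (iterMatrix n).map (fieldDer ξ) - iterMatrix n * B

variable {ξ B}

/-- Both summands of the recursion vanish at 0: one is a derivative along ξ, the other a multiple of
B. -/
theorem iterMatrix_succ_mem (hξ : ∀ i, ξ i ∈ vanishIdeal 𝕜 p 2)
    (hB : ∀ i j, B i j ∈ vanishIdeal 𝕜 p 1) (n : ℕ) (i j : Fin q) :
    iterMatrix ξ B (n + 1) i j ∈ vanishIdeal 𝕜 p 1 := by
  simp only [iterMatrix, Matrix.sub_apply, Matrix.map_apply, Matrix.mul_apply]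
  refine Ideal.sub_mem _ ?_ (Ideal.sum_mem _ fun l _ => Ideal.mul_mem_left _ _ (hB l j))
  exact fieldDer_mem hξ (mem_vanishIdeal_zero _)

/-- If `ξ u + B u = e` modulo higher order, the iterates `ξ^n u` are `P n u`, with an additional
term `e` for `n = 1`. -/
theorem iterate_fieldDer_sub_mem (hξ : ∀ i, ξ i ∈ vanishIdeal 𝕜 p 2)
    (hB : ∀ i j, B i j ∈ vanishIdeal 𝕜 p 1) {k : ℕ} {u e : Fin q → Ep 𝕜 p}
    (he : ∀ j, e j ∈ vanishIdeal 𝕜 p (k + 1))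
    (hu : ∀ j, fieldDer ξ (u j) + B.mulVec u j - e j ∈ vanishIdeal 𝕜 p (k + 2)) (n : ℕ)
    (j : Fin q) :
    (fieldDer ξ)^[n] (u j) - (iterMatrix ξ B n).mulVec u j - (if n = 1 then e j else 0) ∈
      vanishIdeal 𝕜 p (k + 2) := by
  -- Applying ξ to ξ^n u ≡ P_n u + r kills r modulo order k + 2. The Leibniz rule and ξ u ≡ e - B u
  -- then produce P_(n+1) u and the new remainder P_n e.
  have step : ∀ n, ∀ r : Fin q → Ep 𝕜 p, (∀ j, r j ∈ vanishIdeal 𝕜 p (k + 1)) → (∀ j,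
      (fieldDer ξ)^[n] (u j) - (iterMatrix ξ B n).mulVec u j - r j ∈ vanishIdeal 𝕜 p (k + 2)) →
      ∀ j, (fieldDer ξ)^[n + 1] (u j) - (iterMatrix ξ B (n + 1)).mulVec u j
        - (iterMatrix ξ B n).mulVec e j ∈ vanishIdeal 𝕜 p (k + 2) := by
    intro n r hr h j
    have h1 := vanishIdeal_anti (Nat.le_succ _) (fieldDer_mem hξ (h j))
    have h2 : fieldDer ξ (r j) ∈ vanishIdeal 𝕜 p (k + 2) := fieldDer_mem hξ (hr j)
    have h3 : ∑ l, iterMatrix ξ B n j l * (fieldDer ξ (u l) + B.mulVec u l - e l) ∈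
        vanishIdeal 𝕜 p (k + 2) := Ideal.sum_mem _ fun l _ => Ideal.mul_mem_left _ _ (hu l)
    have h4 := Ideal.add_mem _ (Ideal.add_mem _ h1 h2) h3
    convert h4 using 1
    have e1 : (iterMatrix ξ B n * B).mulVec u j = ∑ l, iterMatrix ξ B n j l * B.mulVec u l := by
      rw [← Matrix.mulVec_mulVec]
      rfl
    have e2 : fieldDer ξ ((iterMatrix ξ B n).mulVec u j) =
        ((iterMatrix ξ B n).map (fieldDer ξ)).mulVec u j +
          ∑ l, iterMatrix ξ B n j l * fieldDer ξ (u l) := by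
      simp only [Matrix.mulVec, dotProduct, map_sum, Derivation.leibniz, smul_eq_mul,
        Matrix.map_apply, Finset.sum_add_distrib]
      rw [add_comm]
      congr 1
      exact Finset.sum_congr rfl fun l _ => mul_comm _ _
    have e3 : (iterMatrix ξ B n).mulVec e j = ∑ l, iterMatrix ξ B n j l * e l := rfl
    rw [iterMatrix, Matrix.sub_mulVec, Pi.sub_apply, e1, e3, map_sub, map_sub, e2,
      Function.iterate_succ_apply']
    simp only [mul_sub, mul_add, Finset.sum_add_distrib, Finset.sum_sub_distrib]
    abel
  have main : ∀ n j, (fieldDer ξ)^[n] (u j) - (iterMatrix ξ B n).mulVec u j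
      - (if n = 1 then e j else 0) ∈ vanishIdeal 𝕜 p (k + 2) := by
    intro n
    induction n with
    | zero => simp [iterMatrix]
    | succ n ih =>
      intro j
      have h := step n (fun j => if n = 1 then e j else 0) (fun j => by
        split_ifs
        · exact he j
        · exact zero_mem _) ih j
      -- The remainder P_n e is e for n = 0; for n ≥ 1 it is negligible, as P_n has entries in 𝔪 and
      -- e has order k + 1.
      cases n with
      | zero => simpa [iterMatrix] using h
      | succ n =>
        have h5 : (iterMatrix ξ B (n + 1)).mulVec e j ∈ vanishIdeal 𝕜 p (k + 2) := by
          simp only [Matrix.mulVec, dotProduct]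
          refine Ideal.sum_mem (vanishIdeal 𝕜 p (k + 2)) fun l _ => ?_
          have := mul_mem_vanishIdeal (iterMatrix_succ_mem hξ hB n j l) (he l)
          rwa [show 1 + (k + 1) = k + 2 by omega] at this
        have := Ideal.add_mem _ h h5
        simpa using this
  exact main n j

end ExpansionAlongField

/-! ### Flows with 1-jet the identity and Taylor expansion in time -/

theorem SmoothNear.congr {E F : Type*} [NormedAddCommGroup E] [NormedSpace 𝕜 E]
    [NormedAddCommGroup F] [NormedSpace 𝕜 F] {f g : E → F} {a : E} (hf : SmoothNear 𝕜 f a)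
    (h : g =ᶠ[𝓝 a] f) : SmoothNear 𝕜 g a := by
  filter_upwards [hf, h.eventuallyEq_nhds] with x h1 h2 using h1.congr_of_eventuallyEq h2

/-- If all time-`t` maps of a flow have derivative the identity at `0`, then its velocity field has
derivative zero there. -/
theorem hasFDerivAt_zero_of_flow {E : Type*} [NormedAddCommGroup E] [NormedSpace 𝕜 E]
    {Φ : 𝕜 × E → E} {X : E → E} (hsm : ContDiffAt 𝕜 ∞ Φ (0, 0))
    (hd : ∀ᶠ z in 𝓝 ((0 : 𝕜), (0 : E)), DifferentiableAt 𝕜 Φ z)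
    (hode : ∀ᶠ x in 𝓝 (0 : E), HasDerivAt (fun t => Φ (t, x)) (X x) 0)
    (hjet : ∀ᶠ t in 𝓝 (0 : 𝕜), HasFDerivAt (fun x => Φ (t, x)) (ContinuousLinearMap.id 𝕜 E) 0) :
    HasFDerivAt X (0 : E →L[𝕜] E) 0 := by
  have hsymm : IsSymmSndFDerivAt 𝕜 Φ (0, 0) := hsm.isSymmSndFDerivAt (by
    rw [minSmoothness_of_isRCLikeNormedField]
    exact WithTop.coe_le_coe.2 (le_top : (2 : ℕ∞) ≤ ⊤))
  have hD2 : HasFDerivAt (fderiv 𝕜 Φ) (fderiv 𝕜 (fderiv 𝕜 Φ) (0, 0)) (0, 0) :=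
    ((hsm.fderiv_right (m := ∞) le_rfl).differentiableAt (by simp)).hasFDerivAt
  set L := fderiv 𝕜 (fderiv 𝕜 Φ) (0, 0) with hL
  -- The space derivative of Φ along t ↦ (t, 0) is constantly the identity, so the mixed derivative
  -- (first t, then x) is zero. By symmetry of second derivatives it equals the derivative of X =
  -- ∂Φ/∂t at time 0.
  have hA : ∀ v : E, L (1, 0) (0, v) = 0 := by
    intro v
    have h1 : HasDerivAt (fun t : 𝕜 => (t, (0 : E))) (1, 0) 0 :=
      (hasDerivAt_id 0).prodMk (hasDerivAt_const _ _)
    have h2 : HasDerivAt (fun t : 𝕜 => fderiv 𝕜 Φ (t, 0)) (L (1, 0)) 0 :=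
      HasFDerivAt.comp_hasDerivAt (0 : 𝕜) (by exact hD2) h1
    have h2' : HasDerivAt (fun t : 𝕜 => fderiv 𝕜 Φ (t, 0) (0, v)) (L (1, 0) (0, v)) 0 :=
      (ContinuousLinearMap.apply 𝕜 E ((0 : 𝕜), v)).hasFDerivAt.comp_hasDerivAt (0 : 𝕜) h2
    have h3 : HasDerivAt (fun t : 𝕜 => fderiv 𝕜 Φ (t, 0) (0, v)) 0 0 := by
      refine (hasDerivAt_const (0 : 𝕜) v).congr_of_eventuallyEq ?_
      have hc : Tendsto (fun t : 𝕜 => (t, (0 : E))) (𝓝 0) (𝓝 (0, 0)) :=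
        (Continuous.prodMk_left (0 : E)).tendsto 0
      filter_upwards [hjet, hc.eventually hd] with t ht ht'
      have h4 : HasFDerivAt (fun x : E => (t, x))
          (ContinuousLinearMap.inr 𝕜 𝕜 E) 0 := hasFDerivAt_prodMk_right t 0
      have h5 := (ht'.hasFDerivAt.comp (0 : E) h4).unique ht
      have h6 := congrArg (fun T : E →L[𝕜] E => T v) h5
      simpa using h6
    exact h2'.unique h3
  have h1 : HasFDerivAt (fun x : E => ((0 : 𝕜), x)) (ContinuousLinearMap.inr 𝕜 𝕜 E) 0 :=
    hasFDerivAt_prodMk_right 0 0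
  have h2 : HasFDerivAt (fun x : E => fderiv 𝕜 Φ (0, x)) (L.comp (ContinuousLinearMap.inr 𝕜 𝕜 E)) 0 :=
    HasFDerivAt.comp (0 : E) (by exact hD2) h1
  have h2' : HasFDerivAt (fun x : E => fderiv 𝕜 Φ (0, x) (1, 0))
      ((ContinuousLinearMap.apply 𝕜 E ((1 : 𝕜), (0 : E))).comp
        (L.comp (ContinuousLinearMap.inr 𝕜 𝕜 E))) 0 :=
    (ContinuousLinearMap.apply 𝕜 E ((1 : 𝕜), (0 : E))).hasFDerivAt.comp (0 : E) h2
  have h3 : X =ᶠ[𝓝 0] fun x => fderiv 𝕜 Φ (0, x) (1, 0) := by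
    have hc : Tendsto (fun x : E => ((0 : 𝕜), x)) (𝓝 0) (𝓝 (0, 0)) :=
      (Continuous.prodMk_right (0 : 𝕜)).tendsto 0
    filter_upwards [hode, hc.eventually hd] with x hx hx'
    have h4 : HasDerivAt (fun t : 𝕜 => (t, x)) (1, 0) 0 :=
      (hasDerivAt_id 0).prodMk (hasDerivAt_const _ _)
    exact hx.unique (HasFDerivAt.comp_hasDerivAt (0 : 𝕜) (by exact hx'.hasFDerivAt) h4)
  refine (h2'.congr_of_eventuallyEq h3).congr_fderiv ?_
  ext v
  have h5 := hA v
  rw [hsymm] at h5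
  simpa using h5

/-- A local flow of `ξ` with the properties that define `Θ_{V,1}`, on the product of two balls of
radius `δ`, together with a linear bound. -/
structure IsUniformFlow (V : Set (Fin p → 𝕜)) (ξ : Fin p → Ep 𝕜 p)
    (X : (Fin p → 𝕜) → (Fin p → 𝕜)) (Φ : 𝕜 × (Fin p → 𝕜) → (Fin p → 𝕜)) (δ C : ℝ) : Prop where
  pos : 0 < δ
  nonneg : 0 ≤ C
  rep : ∀ i, (ξ i : Germ (𝓝 (0 : Fin p → 𝕜)) 𝕜) = ((fun x => X x i : (Fin p → 𝕜) → 𝕜) : Germ _ 𝕜)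
  initial : ∀ x, ‖x‖ < δ → Φ (0, x) = x
  smooth : ∀ t x, ‖t‖ < δ → ‖x‖ < δ → ContDiffAt 𝕜 ∞ Φ (t, x)
  ode : ∀ t x, ‖t‖ < δ → ‖x‖ < δ → HasDerivAt (fun s => Φ (s, x)) (X (Φ (t, x))) t
  bound : ∀ t x, ‖t‖ < δ → ‖x‖ < δ → ‖Φ (t, x)‖ ≤ C * ‖x‖
  preserves : ∀ t x, ‖t‖ < δ → ‖x‖ < δ → (x ∈ V ↔ Φ (t, x) ∈ V)
  oneJet : ∀ t, ‖t‖ < δ → HasOneJetId fun x => Φ (t, x)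

/-- The finitely many germ conditions hold on one common radius. The linear bound is the local
Lipschitz estimate for Φ, combined with Φ_t(0) = 0. -/
theorem exists_isUniformFlow {V : Set (Fin p → 𝕜)} {ξ : Fin p → Ep 𝕜 p} (hξ : ξ ∈ Theta1 V) :
    ∃ X Φ δ C, IsUniformFlow V ξ X Φ δ C := by
  obtain ⟨Φ, hΦ, hV, hj⟩ := hξ
  obtain ⟨X, hX, hode⟩ := hΦ.ode
  obtain ⟨K, s, hs, hK⟩ := (hΦ.smooth.self_of_nhds.of_le
    (by exact_mod_cast le_top : (1 : ℕ∞ω) ≤ ∞)).exists_lipschitzOnWith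
  obtain ⟨δ₁, h1, hδ₁⟩ := Metric.eventually_nhds_iff_ball.1
    (((hΦ.smooth.and hode).and hV).and hs)
  obtain ⟨δ₂, h2, hδ₂⟩ := Metric.eventually_nhds_iff_ball.1 hΦ.initial
  obtain ⟨δ₃, h3, hδ₃⟩ := Metric.eventually_nhds_iff_ball.1 hj
  have hmem : ∀ (t : 𝕜) (x : Fin p → 𝕜), ‖t‖ < min δ₁ (min δ₂ δ₃) → ‖x‖ < min δ₁ (min δ₂ δ₃) →
      (t, x) ∈ Metric.ball (0 : 𝕜 × (Fin p → 𝕜)) δ₁ := by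
    intro t x ht hx
    rw [mem_ball_zero_iff, Prod.norm_def]
    exact max_lt (ht.trans_le (min_le_left _ _)) (hx.trans_le (min_le_left _ _))
  have hjet : ∀ t : 𝕜, ‖t‖ < min δ₁ (min δ₂ δ₃) → HasOneJetId fun x => Φ (t, x) := fun t ht =>
    hδ₃ t (mem_ball_zero_iff.2 (ht.trans_le ((min_le_right _ _).trans (min_le_right _ _))))
  have hpos : 0 < min δ₁ (min δ₂ δ₃) := lt_min h1 (lt_min h2 h3)
  refine ⟨X, Φ, min δ₁ (min δ₂ δ₃), K, hpos, K.2, hX, ?_,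
    fun t x ht hx => (hδ₁ _ (hmem t x ht hx)).1.1.1,
    fun t x ht hx => (hδ₁ _ (hmem t x ht hx)).1.1.2, ?_,
    fun t x ht hx => (hδ₁ _ (hmem t x ht hx)).1.2, hjet⟩
  · exact fun x hx =>
      hδ₂ x (mem_ball_zero_iff.2 (hx.trans_le ((min_le_right _ _).trans (min_le_left _ _))))
  · intro t x ht hx
    have h5 := hK.norm_sub_le (hδ₁ _ (hmem t x ht hx)).2
      (hδ₁ _ (hmem t 0 ht (by simpa using hpos))).2
    have h6 : Φ (t, 0) = 0 := (hjet t ht).1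
    simpa [h6, Prod.norm_def] using h5

namespace IsUniformFlow

variable {V : Set (Fin p → 𝕜)} {ξ : Fin p → Ep 𝕜 p} {X : (Fin p → 𝕜) → (Fin p → 𝕜)}
  {Φ : 𝕜 × (Fin p → 𝕜) → (Fin p → 𝕜)} {δ C : ℝ}

theorem smoothNear_field (H : IsUniformFlow V ξ X Φ δ C) : SmoothNear 𝕜 X 0 := by
  have : ∀ i, SmoothNear 𝕜 (fun x => X x i) 0 := by
    intro i
    obtain ⟨f, hf, h⟩ := (ξ i).2
    exact hf.congr (Germ.coe_eq.1 ((H.rep i).symm.trans h))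
  filter_upwards [eventually_all.2 this] with x hx using contDiffAt_pi.2 hx

theorem fieldDer_mk (H : IsUniformFlow V ξ X Φ δ C) {f : (Fin p → 𝕜) → 𝕜}
    (hf : SmoothNear 𝕜 f 0) : ∃ hf' : SmoothNear 𝕜 (fun x => fderiv 𝕜 f x (X x)) 0,
      fieldDer ξ (Ep.mk f hf) = Ep.mk _ hf' := by
  have hX : ∀ i, SmoothNear 𝕜 (fun x => X x i) 0 := fun i =>
    H.smoothNear_field.mono fun _ h => contDiffAt_pi.1 h i
  refine ⟨?_, ?_⟩
  · filter_upwards [hf.fderiv, H.smoothNear_field] with x h1 h2 using h1.clm_apply h2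
  · have hξ : ∀ i, ξ i = Ep.mk (fun x => X x i) (hX i) := fun i => Subtype.ext (H.rep i)
    rw [fieldDer_apply]
    have : ∀ i, ξ i * pderiv i (Ep.mk f hf) = Ep.mk
        (fun x => X x i * fderiv 𝕜 f x (Pi.single i 1)) ((hX i).fun_mul (hf.fderiv_apply _)) := by
      intro i
      rw [hξ i, pderiv_mk, Ep.mk_mul]
    rw [Finset.sum_congr rfl fun i _ => this i, Ep.mk_sum]
    refine Ep.mk_congr _ fun x => ?_
    conv_rhs => rw [pi_eq_sum_univ' (X x), map_sum]
    refine Finset.sum_congr rfl fun i _ => ?_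
    rw [map_smul, smul_eq_mul]

/-- A vector field whose flow has 1-jet the identity vanishes to second order. -/
theorem mem_vanishIdeal (H : IsUniformFlow V ξ X Φ δ C) (i : Fin p) :
    ξ i ∈ vanishIdeal 𝕜 p 2 := by
  have hball : ∀ᶠ t : 𝕜 in 𝓝 0, ‖t‖ < δ := by
    filter_upwards [Metric.ball_mem_nhds (0 : 𝕜) H.pos] with t ht using mem_ball_zero_iff.1 ht
  have hball' : ∀ᶠ x : Fin p → 𝕜 in 𝓝 0, ‖x‖ < δ := by
    filter_upwards [Metric.ball_mem_nhds (0 : Fin p → 𝕜) H.pos] with x hx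
      using mem_ball_zero_iff.1 hx
  have h0 : ‖(0 : 𝕜)‖ < δ := by simpa using H.pos
  have h0' : ‖(0 : Fin p → 𝕜)‖ < δ := by simpa using H.pos
  have hX0 : X 0 = 0 := by
    have h1 := H.ode 0 0 h0 h0'
    rw [H.initial 0 h0'] at h1
    refine h1.unique ((hasDerivAt_const (0 : 𝕜) (0 : Fin p → 𝕜)).congr_of_eventuallyEq ?_)
    filter_upwards [hball] with t ht using (H.oneJet t ht).1
  have hsm : ContDiffAt 𝕜 ∞ Φ (0, 0) := H.smooth 0 0 h0 h0'
  have hd : ∀ᶠ z in 𝓝 ((0 : 𝕜), (0 : Fin p → 𝕜)), DifferentiableAt 𝕜 Φ z := by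
    rw [nhds_prod_eq]
    filter_upwards [hball.prod_mk hball'] with z hz
    exact (H.smooth z.1 z.2 hz.1 hz.2).differentiableAt (by simp)
  have hX' : HasFDerivAt X (0 : (Fin p → 𝕜) →L[𝕜] (Fin p → 𝕜)) 0 := by
    refine hasFDerivAt_zero_of_flow hsm hd ?_ ?_
    · filter_upwards [hball'] with x hx
      simpa only [H.initial x hx] using H.ode 0 x h0 hx
    · filter_upwards [hball] with t ht using (H.oneJet t ht).2
  have hO : X =O[𝓝 0] fun x => ‖x‖ ^ 2 := by
    simpa [taylorSum, Finset.sum_range_succ, hX0, hX'.fderiv] using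
      H.smoothNear_field.sub_taylorSum_isBigO 2
  have hX : SmoothNear 𝕜 (fun x => X x i) 0 :=
    H.smoothNear_field.mono fun _ h => contDiffAt_pi.1 h i
  rw [show ξ i = Ep.mk (fun x => X x i) hX from Subtype.ext (H.rep i), mk_mem_vanishIdeal]
  exact isBigO_pi.1 hO i

/-- The time-`t` map of the flow. -/
def timeMap (H : IsUniformFlow V ξ X Φ δ C) {t : 𝕜} (ht : ‖t‖ < δ) : MapGerm 𝕜 p p where
  toFun x := Φ (t, x)
  smooth' := by
    filter_upwards [Metric.ball_mem_nhds (0 : Fin p → 𝕜) H.pos] with x hx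
    exact (H.smooth t x ht (mem_ball_zero_iff.1 hx)).comp x
      (contDiffAt_const.prodMk contDiffAt_id)
  map_zero' := (H.oneJet t ht).1

/-- The Taylor expansion in time of a function along the flow, modulo germs of high order. -/
theorem pullback_timeMap_sub_mem (H : IsUniformFlow V ξ X Φ δ C) {t : 𝕜} (ht : ‖t‖ < δ)
    {a : Ep 𝕜 p} {K m : ℕ} (ha : (fieldDer ξ)^[K] a ∈ vanishIdeal 𝕜 p m) :
    (H.timeMap ht).pullback a -
      ∑ n ∈ Finset.range K, Ep.const (t ^ n * (n.factorial : 𝕜)⁻¹) * (fieldDer ξ)^[n] a ∈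
        vanishIdeal 𝕜 p m := by
  obtain ⟨f, hf, rfl⟩ := a.exists_rep
  set D : ((Fin p → 𝕜) → 𝕜) → ((Fin p → 𝕜) → 𝕜) := fun f x => fderiv 𝕜 f x (X x) with hD
  have hF : ∀ n, ∃ hn : SmoothNear 𝕜 (D^[n] f) 0,
      (fieldDer ξ)^[n] (Ep.mk f hf) = Ep.mk (D^[n] f) hn := by
    intro n
    induction n with
    | zero => exact ⟨hf, rfl⟩
    | succ n ih =>
      obtain ⟨h1, h2⟩ := ih
      obtain ⟨h3, h4⟩ := H.fieldDer_mk h1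
      simp only [Function.iterate_succ_apply']
      exact ⟨h3, by rw [h2, h4]⟩
  choose hs he using hF
  rw [he, mk_mem_vanishIdeal] at ha
  have hsum : ∑ n ∈ Finset.range K, Ep.const (t ^ n * (n.factorial : 𝕜)⁻¹) *
      (fieldDer ξ)^[n] (Ep.mk f hf) = ∑ n ∈ Finset.range K,
        Ep.mk (fun x => (t ^ n * (n.factorial : 𝕜)⁻¹) * (D^[n] f) x)
          ((smoothNear_const _).fun_mul (hs n)) := by
    refine Finset.sum_congr rfl fun n _ => ?_
    rw [he]
    rfl
  rw [hsum, Ep.mk_sum, pullback_mk, Ep.mk_sub, mk_mem_vanishIdeal]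
  obtain ⟨M, hM0, hM⟩ := ha.exists_pos
  have hall : ∀ᶠ y in 𝓝 (0 : Fin p → 𝕜), (∀ n ∈ Finset.range K, ContDiffAt 𝕜 ∞ (D^[n] f) y) ∧
      ‖(D^[K] f) y‖ ≤ M * ‖‖y‖ ^ m‖ :=
    ((Filter.eventually_all_finset _).2 fun n _ => hs n).and hM.bound
  obtain ⟨r, hr, hball⟩ := Metric.eventually_nhds_iff_ball.1 hall
  have hC := H.nonneg
  have hev : ∀ᶠ x in 𝓝 (0 : Fin p → 𝕜), C * ‖x‖ < r := by
    have : Continuous fun x : Fin p → 𝕜 => C * ‖x‖ := by fun_prop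
    exact this.continuousAt.eventually_lt_const (by simpa using hr)
  refine IsBigO.of_bound (M * C ^ m * ‖t‖ ^ K) ?_
  filter_upwards [hev, Metric.ball_mem_nhds (0 : Fin p → 𝕜) H.pos] with x hx hxδ
  have hxδ : ‖x‖ < δ := mem_ball_zero_iff.1 hxδ
  have hsδ : ∀ s ∈ Metric.closedBall (0 : 𝕜) ‖t‖, ‖s‖ < δ := fun s hs =>
    (mem_closedBall_zero_iff.1 hs).trans_lt ht
  have hmem : ∀ s ∈ Metric.closedBall (0 : 𝕜) ‖t‖, Φ (s, x) ∈ Metric.ball (0 : Fin p → 𝕜) r :=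
    fun s hs => mem_ball_zero_iff.2 ((H.bound s x (hsδ s hs) hxδ).trans_lt hx)
  -- Along an orbit, differentiation in time is application of ξ, so s ↦ (ξ^n f)(Φ_s(x)) is a chain
  -- of successive derivatives. Its last member is at most M ‖Φ_s(x)‖^m ≤ M (C ‖x‖)^m.
  have key := norm_sub_taylor_sum_le (𝕜 := 𝕜) (K := K) (R := ‖t‖) (C := M * (C * ‖x‖) ^ m)
    (u := fun n s => (D^[n] f) (Φ (s, x)))
    (fun n hn s hs => by
      have h1 := ((hball _ (hmem s hs)).1 n (Finset.mem_range.2 hn)).differentiableAt (by simp)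
      have h2 := h1.hasFDerivAt.comp_hasDerivAt s (H.ode s x (hsδ s hs) hxδ)
      simp only [Function.iterate_succ_apply']
      exact h2)
    (fun s hs => by
      refine (hball _ (hmem s hs)).2.trans ?_
      rw [norm_pow, norm_norm]
      gcongr
      exact H.bound s x (hsδ s hs) hxδ) t (by simp)
  simp only [Function.iterate_zero, id_eq, H.initial x hxδ, smul_eq_mul] at key
  refine key.trans (le_of_eq ?_)
  rw [norm_pow, norm_norm, mul_pow]
  ring

end IsUniformFlow

/-! ### Composing equivalences and building them from matrices -/

theorem IsDiffeoGerm.tendsto {E : Type*} [NormedAddCommGroup E] [NormedSpace 𝕜 E] {Ψ : E → E}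
    (h : IsDiffeoGerm 𝕜 Ψ) : Tendsto Ψ (𝓝 0) (𝓝 0) := by
  simpa [ContinuousAt, h.1] using h.2.1.self_of_nhds.continuousAt

theorem IsDiffeoGerm.comp {E : Type*} [NormedAddCommGroup E] [NormedSpace 𝕜 E] {Ψ₁ Ψ₂ : E → E}
    (h₂ : IsDiffeoGerm 𝕜 Ψ₂) (h₁ : IsDiffeoGerm 𝕜 Ψ₁) :
    IsDiffeoGerm 𝕜 (fun z => Ψ₂ (Ψ₁ z)) := by
  have ht₁ := h₁.tendsto
  obtain ⟨a₁, s₁, Θ₁, b₁, r₁, l₁, m₁⟩ := h₁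
  obtain ⟨a₂, s₂, Θ₂, b₂, r₂, l₂, m₂⟩ := h₂
  have ht₂ : Tendsto Θ₂ (𝓝 0) (𝓝 0) := by
    simpa [ContinuousAt, b₂] using r₂.self_of_nhds.continuousAt
  refine ⟨by simp [a₁, a₂], s₂.comp s₁ a₁, fun z => Θ₁ (Θ₂ z), by simp [b₁, b₂], r₁.comp r₂ b₂,
    ?_, ?_⟩
  · filter_upwards [l₁, ht₁.eventually l₂] with z h1 h2
    rw [h2, h1]
  · filter_upwards [m₂, ht₂.eventually m₁] with z h1 h2
    rw [h2, h1]

theorem MapsGermOnto.comp {E : Type*} [NormedAddCommGroup E] {Ψ₁ Ψ₂ : E → E} {A B D : Set E}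
    (h₂ : MapsGermOnto Ψ₂ B D) (h₁ : MapsGermOnto Ψ₁ A B) (ht : Tendsto Ψ₁ (𝓝 0) (𝓝 0)) :
    MapsGermOnto (fun z => Ψ₂ (Ψ₁ z)) A D := by
  unfold MapsGermOnto at *
  filter_upwards [h₁, ht.eventually h₂] with z h1 h2 using h1.trans h2

theorem HasOneJetId.comp {ψ₁ ψ₂ : (Fin p → 𝕜) → (Fin p → 𝕜)} (h₂ : HasOneJetId ψ₂)
    (h₁ : HasOneJetId ψ₁) : HasOneJetId fun x => ψ₂ (ψ₁ x) := by
  refine ⟨by simp [h₁.1, h₂.1], ?_⟩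
  have h3 : HasFDerivAt ψ₂ (ContinuousLinearMap.id 𝕜 (Fin p → 𝕜)) (ψ₁ 0) := by
    rw [h₁.1]
    exact h₂.2
  simpa using h3.comp (0 : Fin p → 𝕜) h₁.2

theorem VK1Equiv.refl (V : Set (Fin p → 𝕜)) (f : MapGerm 𝕜 p q) : VK1Equiv V f f := by
  refine ⟨id, ⟨?_, ?_, ?_⟩, ?_, rfl, hasFDerivAt_id 0⟩
  · exact isDiffeoGerm_of_hasFDerivAt_id rfl (ContDiff.smoothNear contDiff_id) (hasFDerivAt_id 0)
  all_goals exact Eventually.of_forall fun _ => Iff.rfl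

theorem VK1Equiv.trans {V : Set (Fin p → 𝕜)} {f₁ f₂ f₃ : MapGerm 𝕜 p q} (h₁ : VK1Equiv V f₁ f₂)
    (h₂ : VK1Equiv V f₂ f₃) : VK1Equiv V f₁ f₃ := by
  obtain ⟨Ψ₁, e₁, v₁, j₁⟩ := h₁
  obtain ⟨Ψ₂, e₂, v₂, j₂⟩ := h₂
  have ht := e₁.diffeo.tendsto
  -- This holds only near 0, where Ψ₁ is known to keep the zero section.
  have hb : (fun x => baseMap Ψ₂ (baseMap Ψ₁ x)) =ᶠ[𝓝 0]
      baseMap fun z => Ψ₂ (Ψ₁ z) := by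
    have hc : Tendsto (fun x : Fin p → 𝕜 => (x, (0 : Fin q → 𝕜))) (𝓝 0) (𝓝 0) :=
      (Continuous.prodMk_left (0 : Fin q → 𝕜)).tendsto 0
    filter_upwards [hc.eventually e₁.preserves_zero] with x hx
    have h0 : (Ψ₁ (x, 0)).2 = 0 := hx.1 rfl
    have h1 : Ψ₁ (x, 0) = ((Ψ₁ (x, 0)).1, 0) := Prod.ext rfl h0
    simp only [baseMap]
    rw [← h1]
  have hbt : Tendsto (baseMap Ψ₁) (𝓝 0) (𝓝 0) := by
    have := j₁.2.continuousAt
    rwa [ContinuousAt, j₁.1] at this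
  have hj := j₂.comp j₁
  refine ⟨fun z => Ψ₂ (Ψ₁ z), ⟨e₂.diffeo.comp e₁.diffeo,
    e₂.preserves_zero.comp e₁.preserves_zero ht, e₂.maps_graph.comp e₁.maps_graph ht⟩, ?_, ?_, ?_⟩
  · have hv := v₂.comp v₁ hbt
    unfold MapsGermOnto at *
    filter_upwards [hv, hb] with x h1 h2
    rwa [h2] at h1
  · rw [← hb.self_of_nhds]
    exact hj.1
  · exact hj.2.congr_of_eventuallyEq hb.symm

theorem comps_mem_vanishIdeal (f : MapGerm 𝕜 p q) (j : Fin q) :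
    f.comps j ∈ vanishIdeal 𝕜 p 1 := by
  rw [vanishIdeal_one]
  exact mk_mem_maxIdeal.2 (by simp [f.map_zero'])

/-- A diffeomorphism germ of the source together with an invertible matrix of function germs gives
a `_V𝒦_1`-equivalence. -/
theorem exists_vk1Equiv_of_matrix {V : Set (Fin p → 𝕜)} (ψ : MapGerm 𝕜 p p)
    (hψ : HasOneJetId ψ.toFun) (hψV : MapsGermOnto ψ.toFun V V)
    {A : Matrix (Fin q) (Fin q) (Ep 𝕜 p)}
    (hA : ∀ i j, A i j - (1 : Matrix (Fin q) (Fin q) (Ep 𝕜 p)) i j ∈ vanishIdeal 𝕜 p 1)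
    (g : MapGerm 𝕜 p q) :
    ∃ (f : MapGerm 𝕜 p q) (ψ' : MapGerm 𝕜 p p), VK1Equiv V g f ∧
      (∀ a, ψ'.pullback (ψ.pullback a) = a) ∧
      ∀ j, f.comps j = ψ'.pullback (A.mulVec g.comps j) := by
  obtain ⟨-, -, χ, hχ0, hχs, hχl, hχr⟩ := isDiffeoGerm_of_hasFDerivAt_id hψ.1 ψ.smooth' hψ.2
  choose a ha hAa using fun i j => (A i j).exists_rep
  have ha0 : ∀ i j, a i j 0 = (1 : Matrix (Fin q) (Fin q) 𝕜) i j := by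
    intro i j
    have h1 := hA i j
    have h2 : (1 : Matrix (Fin q) (Fin q) (Ep 𝕜 p)) i j =
        Ep.const ((1 : Matrix (Fin q) (Fin q) 𝕜) i j) := by
      by_cases h : i = j
      · subst h
        simp
      · simp [Matrix.one_apply_ne h]
    rw [vanishIdeal_one, h2, hAa] at h1
    exact sub_eq_zero.1 ((mk_mem_maxIdeal (hf := (ha i j).fun_sub
      (smoothNear_const ((1 : Matrix (Fin q) (Fin q) 𝕜) i j)))).1 h1)
  set M : (Fin p → 𝕜) → Matrix (Fin q) (Fin q) 𝕜 := fun x => Matrix.of fun i j => a i j x with hM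
  have hM0 : M 0 = 1 := by
    ext i j
    exact ha0 i j
  have hgc : ∀ l, SmoothNear 𝕜 (fun x => g.toFun x l) 0 := fun l =>
    g.smooth'.mono fun _ h => contDiffAt_pi.1 h l
  have hMg : ∀ j, SmoothNear 𝕜 (fun x => ∑ l, a j l x * g.toFun x l) 0 := fun j =>
    .fun_sum fun l => (ha j l).fun_mul (hgc l)
  have hMgA : ∀ j, A.mulVec g.comps j = Ep.mk _ (hMg j) := by
    intro j
    simp only [Matrix.mulVec, dotProduct]
    rw [Finset.sum_congr rfl fun l _ => show A j l * g.comps l =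
      Ep.mk (fun x => a j l x * g.toFun x l) ((ha j l).fun_mul (hgc l)) by rw [hAa]; rfl,
      Ep.mk_sum]
  let ψ' : MapGerm 𝕜 p p := ⟨χ, hχs, hχ0⟩
  let f : MapGerm 𝕜 p q := ⟨fun x => (M (χ x)).mulVec (g.toFun (χ x)), by
      have : ∀ j, SmoothNear 𝕜 (fun x => (M (χ x)).mulVec (g.toFun (χ x)) j) 0 := fun j =>
        (hMg j).comp hχs hχ0
      filter_upwards [eventually_all.2 this] with x hx using contDiffAt_pi.2 hx, by
      simp [hχ0, g.map_zero']⟩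
  refine ⟨f, ψ', ?_, ?_, ?_⟩
  -- The equivalence is fibrewise linear. Its derivative at 0 is the identity because M 0 = 1, and
  -- injectivity of M x near 0 turns preservation of the zero section and of the graphs into
  -- equivalences.
  · set Ψ : (Fin p → 𝕜) × (Fin q → 𝕜) → (Fin p → 𝕜) × (Fin q → 𝕜) :=
      fun z => (ψ.toFun z.1, (M z.1).mulVec z.2) with hΨ
    have hinj : ∀ᶠ z in 𝓝 (0 : (Fin p → 𝕜) × (Fin q → 𝕜)),
        Function.Injective (M z.1).mulVec := by
      have hc : ContinuousAt (fun x => (M x).det) 0 := by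
        have hMc : ContinuousAt M 0 :=
          continuousAt_pi.2 fun i => continuousAt_pi.2 fun j => (ha i j).self_of_nhds.continuousAt
        exact (Continuous.matrix_det continuous_id).continuousAt.comp hMc
      have h1 : ∀ᶠ x in 𝓝 (0 : Fin p → 𝕜), (M x).det ≠ 0 :=
        hc.eventually_ne (by simp [hM0])
      filter_upwards [(continuous_fst.tendsto (0 : (Fin p → 𝕜) × (Fin q → 𝕜))).eventually h1]
        with z hz
      exact Matrix.mulVec_injective_of_isUnit
        ((Matrix.isUnit_iff_isUnit_det _).2 (isUnit_iff_ne_zero.2 hz))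
    have hfst : SmoothNear 𝕜 (fun z : (Fin p → 𝕜) × (Fin q → 𝕜) => z.1) 0 :=
      ContDiff.smoothNear contDiff_fst
    have hsnd : ∀ l, SmoothNear 𝕜 (fun z : (Fin p → 𝕜) × (Fin q → 𝕜) => z.2 l) 0 := fun l =>
      ContDiff.smoothNear ((contDiff_apply 𝕜 𝕜 l).comp contDiff_snd)
    have hΨ0 : Ψ 0 = 0 := by simp [hΨ, ψ.map_zero']
    have hΨs : SmoothNear 𝕜 Ψ 0 := by
      have h1 : SmoothNear 𝕜 (fun z : (Fin p → 𝕜) × (Fin q → 𝕜) => ψ.toFun z.1) 0 :=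
        ψ.smooth'.comp hfst rfl
      have h2 : ∀ j, SmoothNear 𝕜
          (fun z : (Fin p → 𝕜) × (Fin q → 𝕜) => (M z.1).mulVec z.2 j) 0 := fun j =>
        SmoothNear.fun_sum (s := Finset.univ)
          (f := fun l (z : (Fin p → 𝕜) × (Fin q → 𝕜)) => a j l z.1 * z.2 l)
          fun l => SmoothNear.fun_mul ((ha j l).comp hfst rfl) (hsnd l)
      filter_upwards [h1, eventually_all.2 h2] with z h3 h4 using
        h3.prodMk (contDiffAt_pi.2 h4)
    have hΨd : HasFDerivAt Ψ (ContinuousLinearMap.id 𝕜 ((Fin p → 𝕜) × (Fin q → 𝕜))) 0 := by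
      have h1 : HasFDerivAt (fun z : (Fin p → 𝕜) × (Fin q → 𝕜) => ψ.toFun z.1)
          (ContinuousLinearMap.fst 𝕜 (Fin p → 𝕜) (Fin q → 𝕜)) 0 := by
        have h3 : HasFDerivAt ψ.toFun (ContinuousLinearMap.id 𝕜 (Fin p → 𝕜))
          (0 : (Fin p → 𝕜) × (Fin q → 𝕜)).1 := hψ.2
        simpa using h3.comp (0 : (Fin p → 𝕜) × (Fin q → 𝕜)) hasFDerivAt_fst
      have h2 : HasFDerivAt (fun z : (Fin p → 𝕜) × (Fin q → 𝕜) => (M z.1).mulVec z.2)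
          (ContinuousLinearMap.snd 𝕜 (Fin p → 𝕜) (Fin q → 𝕜)) 0 := by
        rw [hasFDerivAt_pi']
        intro j
        -- The product rule term with the derivative of a j l is multiplied by z.2 l, which is 0 at
        -- the origin.
        have h3 : ∀ l, HasFDerivAt
            (fun z : (Fin p → 𝕜) × (Fin q → 𝕜) => a j l z.1 * z.2 l)
            (((1 : Matrix (Fin q) (Fin q) 𝕜) j l) • (ContinuousLinearMap.proj l).comp
              (ContinuousLinearMap.snd 𝕜 (Fin p → 𝕜) (Fin q → 𝕜))) 0 := by
          intro l
          have h4 : DifferentiableAt 𝕜 (fun z : (Fin p → 𝕜) × (Fin q → 𝕜) => a j l z.1) 0 :=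
            (((ha j l).comp hfst rfl).self_of_nhds).differentiableAt (by simp)
          have h5 : HasFDerivAt (fun z : (Fin p → 𝕜) × (Fin q → 𝕜) => z.2 l)
            ((ContinuousLinearMap.proj l).comp
              (ContinuousLinearMap.snd 𝕜 (Fin p → 𝕜) (Fin q → 𝕜))) 0 :=
            ((ContinuousLinearMap.proj l).comp
              (ContinuousLinearMap.snd 𝕜 (Fin p → 𝕜) (Fin q → 𝕜))).hasFDerivAt
          refine (h4.hasFDerivAt.mul h5).congr_fderiv ?_
          ext z <;> simp [ha0]
        refine (HasFDerivAt.fun_sum fun l (_ : l ∈ Finset.univ) => h3 l).congr_fderiv ?_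
        refine ContinuousLinearMap.ext fun z => ?_
        rw [sum_apply]
        change ∑ l, (1 : Matrix (Fin q) (Fin q) 𝕜) j l * z.2 l = z.2 j
        simp [Matrix.one_apply]
      exact h1.prodMk h2
    refine ⟨Ψ, ⟨isDiffeoGerm_of_hasFDerivAt_id hΨ0 hΨs hΨd, ?_, ?_⟩, ?_, ?_⟩
    · unfold MapsGermOnto
      filter_upwards [hinj] with z hz
      simp only [hΨ]
      exact ⟨fun h => by simp [h], fun h => hz (by simpa using h)⟩
    · unfold MapsGermOnto
      filter_upwards [hinj, (continuous_fst.tendsto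
        (0 : (Fin p → 𝕜) × (Fin q → 𝕜))).eventually hχl] with z hz h1
      simp only [MapGerm.graph, Set.mem_ofPred_eq, hΨ, f, h1]
      exact hz.eq_iff.symm
    · exact hψV
    · exact hψ
  · intro b
    obtain ⟨f, hf, rfl⟩ := b.exists_rep
    rw [pullback_mk, pullback_mk, Ep.mk_eq_mk]
    filter_upwards [hχr] with x hx
    simp only [ψ', hx]
  · intro j
    rw [hMgA, pullback_mk]
    rfl

/-- The truncated exponential series built from `iterMatrix`: along the time-`t` map of the flow of
`ξ`, a solution `u` of `ξ u + B u = 0` pulls back to `flowMatrix ξ B t N` times `u`, modulo high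
order. -/
def flowMatrix (ξ : Fin p → Ep 𝕜 p) (B : Matrix (Fin q) (Fin q) (Ep 𝕜 p)) (t : 𝕜) (N : ℕ) :
    Matrix (Fin q) (Fin q) (Ep 𝕜 p) :=
  ∑ n ∈ Finset.range N, Ep.const (p := p) (t ^ n * (n.factorial : 𝕜)⁻¹) • iterMatrix ξ B n

/-! ### Moving a germ along the flow -/

section Step

variable {V : Set (Fin p → 𝕜)} {ξ : Fin p → Ep 𝕜 p} {X : (Fin p → 𝕜) → (Fin p → 𝕜)}
  {Φ : 𝕜 × (Fin p → 𝕜) → (Fin p → 𝕜)} {δ C : ℝ} {B : Matrix (Fin q) (Fin q) (Ep 𝕜 p)}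

/-- The term n = 0 of the series is the identity matrix and the others have entries in 𝔪; `N + 1`
ensures that this term is present. -/
theorem flowMatrix_sub_one_mem (hξ : ∀ i, ξ i ∈ vanishIdeal 𝕜 p 2)
    (hB : ∀ i j, B i j ∈ vanishIdeal 𝕜 p 1) (t : 𝕜) (N : ℕ) (i j : Fin q) :
    flowMatrix ξ B t (N + 1) i j - (1 : Matrix (Fin q) (Fin q) (Ep 𝕜 p)) i j ∈
      vanishIdeal 𝕜 p 1 := by
  rw [flowMatrix, Finset.sum_range_succ', Matrix.add_apply]
  simp only [pow_zero, Nat.factorial_zero, Nat.cast_one, inv_one, mul_one, map_one, one_smul]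
  rw [iterMatrix, add_sub_cancel_right, Matrix.sum_apply]
  exact Ideal.sum_mem _ fun n _ => Ideal.mul_mem_left _ _ (iterMatrix_succ_mem hξ hB n i j)

/-- Replacing ξ^n u by its expansion in the Taylor series in t gives A u + t e with A the flow
matrix. Since A - 1 has entries in 𝔪 and e has order k + 1, t e may be replaced by t A e. -/
theorem pullback_timeMap_sub_flowMatrix_mem (H : IsUniformFlow V ξ X Φ δ C) {t : 𝕜} (ht : ‖t‖ < δ)
    (hB : ∀ i j, B i j ∈ vanishIdeal 𝕜 p 1) {k : ℕ} {u e : Fin q → Ep 𝕜 p}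
    (hu1 : ∀ j, u j ∈ vanishIdeal 𝕜 p 1)
    (he : ∀ j, e j ∈ vanishIdeal 𝕜 p (k + 1))
    (hu : ∀ j, fieldDer ξ (u j) + B.mulVec u j - e j ∈ vanishIdeal 𝕜 p (k + 2)) (j : Fin q) :
    (H.timeMap ht).pullback (u j) -
      (flowMatrix ξ B t (k + 2)).mulVec (fun l => u l + Ep.const t * e l) j ∈
        vanishIdeal 𝕜 p (k + 2) := by
  have hξ := H.mem_vanishIdeal
  have h1 := H.pullback_timeMap_sub_mem ht
    (vanishIdeal_anti (by omega) (fieldDer_iterate_mem hξ (hu1 j) (k + 2)) :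
      (fieldDer ξ)^[k + 2] (u j) ∈ vanishIdeal 𝕜 p (k + 2))
  have h2 : ∑ n ∈ Finset.range (k + 2), Ep.const (t ^ n * (n.factorial : 𝕜)⁻¹) *
      ((fieldDer ξ)^[n] (u j) - (iterMatrix ξ B n).mulVec u j - (if n = 1 then e j else 0)) ∈
      vanishIdeal 𝕜 p (k + 2) := Ideal.sum_mem _ fun n _ =>
    Ideal.mul_mem_left _ _ (iterate_fieldDer_sub_mem hξ hB he hu n j)
  have h3 : ∑ l, (flowMatrix ξ B t (k + 2) j l - (1 : Matrix (Fin q) (Fin q) (Ep 𝕜 p)) j l) * e l ∈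
      vanishIdeal 𝕜 p (k + 2) := by
    refine Ideal.sum_mem _ fun l _ => ?_
    have := mul_mem_vanishIdeal (flowMatrix_sub_one_mem hξ hB t (k + 1) j l) (he l)
    rwa [show 1 + (k + 1) = k + 2 by omega] at this
  have e1 : ∑ n ∈ Finset.range (k + 2), Ep.const (t ^ n * (n.factorial : 𝕜)⁻¹) *
      (if n = 1 then e j else 0) = Ep.const t * e j := by
    rw [Finset.sum_eq_single 1]
    · simp
    · intro n _ hn
      simp [hn]
    · intro h
      exact absurd (Finset.mem_range.2 (by omega)) h
  have e2 : (flowMatrix ξ B t (k + 2)).mulVec u j = ∑ n ∈ Finset.range (k + 2),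
      Ep.const (t ^ n * (n.factorial : 𝕜)⁻¹) * (iterMatrix ξ B n).mulVec u j := by
    rw [flowMatrix, Matrix.sum_mulVec, Finset.sum_apply]
    refine Finset.sum_congr rfl fun n _ => ?_
    rw [Matrix.smul_mulVec, Pi.smul_apply, smul_eq_mul]
  have e3 : (flowMatrix ξ B t (k + 2)).mulVec (fun l => u l + Ep.const t * e l) j =
      (flowMatrix ξ B t (k + 2)).mulVec u j +
        Ep.const t * (flowMatrix ξ B t (k + 2)).mulVec e j := by
    simp only [Matrix.mulVec, dotProduct, mul_add, Finset.sum_add_distrib, Finset.mul_sum]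
    congr 1
    exact Finset.sum_congr rfl fun l _ => by ring
  have e4 : ∑ l, (flowMatrix ξ B t (k + 2) j l - (1 : Matrix (Fin q) (Fin q) (Ep 𝕜 p)) j l) * e l =
      (flowMatrix ξ B t (k + 2)).mulVec e j - e j := by
    simp only [sub_mul, Finset.sum_sub_distrib]
    congr 1
    simp [Matrix.one_apply]
  rw [e4] at h3
  have h4 := Ideal.sub_mem _ (Ideal.add_mem _ h1 h2) (Ideal.mul_mem_left _ (Ep.const t) h3)
  convert h4 using 1
  simp only [mul_sub, Finset.sum_sub_distrib]
  rw [e1, e3, e2]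
  ring

/-- For small time, moving along `-(ξ + B)` changes `g` by a `_V𝒦_1`-equivalence and subtracts
`t (ξ(h) + B h)` modulo higher order. -/
theorem exists_vk1Equiv_sub_mem (H : IsUniformFlow V ξ X Φ δ C) {t : 𝕜} (ht : ‖t‖ < δ)
    (hB : ∀ i j, B i j ∈ vanishIdeal 𝕜 p 1) {k : ℕ} {g h : MapGerm 𝕜 p q} {e : Fin q → Ep 𝕜 p}
    (he : ∀ j, e j ∈ vanishIdeal 𝕜 p (k + 1))
    (hh : ∀ j, fieldDer ξ (h.comps j) + B.mulVec h.comps j - e j ∈ vanishIdeal 𝕜 p (k + 2))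
    (hg : ∀ j, g.comps j - h.comps j ∈ vanishIdeal 𝕜 p (k + 1)) :
    ∃ f : MapGerm 𝕜 p q, VK1Equiv V g f ∧
      ∀ j, f.comps j - (g.comps j - Ep.const t * e j) ∈ vanishIdeal 𝕜 p (k + 2) := by
  have hξ := H.mem_vanishIdeal
  -- The target germ is taken as unknown: with this u, the vector u + t e on which the flow matrix
  -- acts is exactly g.
  set u : Fin q → Ep 𝕜 p := fun j => g.comps j - Ep.const t * e j with hu_def
  have huh : ∀ j, u j - h.comps j ∈ vanishIdeal 𝕜 p (k + 1) := fun j => by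
    have := Ideal.sub_mem _ (hg j) (Ideal.mul_mem_left _ (Ep.const t) (he j))
    convert this using 1
    simp only [hu_def]
    ring
  have hu1 : ∀ j, u j ∈ vanishIdeal 𝕜 p 1 := fun j => Ideal.sub_mem _ (comps_mem_vanishIdeal g j)
    (Ideal.mul_mem_left _ _ (vanishIdeal_anti (by omega) (he j)))
  have hu : ∀ j, fieldDer ξ (u j) + B.mulVec u j - e j ∈ vanishIdeal 𝕜 p (k + 2) := by
    intro j
    have h1 : fieldDer ξ (u j - h.comps j) ∈ vanishIdeal 𝕜 p (k + 2) := fieldDer_mem hξ (huh j)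
    have h2 : ∑ l, B j l * (u l - h.comps l) ∈ vanishIdeal 𝕜 p (k + 2) := by
      refine Ideal.sum_mem _ fun l _ => ?_
      have := mul_mem_vanishIdeal (hB j l) (huh l)
      rwa [show 1 + (k + 1) = k + 2 by omega] at this
    have h3 := Ideal.add_mem _ (Ideal.add_mem _ h1 h2) (hh j)
    convert h3 using 1
    simp only [map_sub, Matrix.mulVec, dotProduct, mul_sub, Finset.sum_sub_distrib]
    ring
  have hV : MapsGermOnto (H.timeMap ht).toFun V V := by
    unfold MapsGermOnto
    filter_upwards [Metric.ball_mem_nhds (0 : Fin p → 𝕜) H.pos] with x hx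
    exact H.preserves t x ht (mem_ball_zero_iff.1 hx)
  obtain ⟨f, ψ', hf, hψ', hfc⟩ := exists_vk1Equiv_of_matrix (H.timeMap ht) (H.oneJet t ht) hV
    (flowMatrix_sub_one_mem hξ hB t (k + 1)) g
  refine ⟨f, hf, fun j => ?_⟩
  have h1 := pullback_timeMap_sub_flowMatrix_mem H ht hB hu1 he hu j
  have h2 := pullback_mem_vanishIdeal ψ' h1
  rw [map_sub, hψ'] at h2
  have h3 : (fun l => u l + Ep.const t * e l) = g.comps := by
    funext l
    simp [hu_def]
  rw [h3, ← hfc j] at h2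
  rw [← neg_mem_iff, neg_sub]
  exact h2

/-- Moving along `-(ξ + B)` for time one. -/
theorem exists_vk1Equiv_sub_mem_of_theta1 (hξV : ξ ∈ Theta1 V)
    (hB : ∀ i j, B i j ∈ vanishIdeal 𝕜 p 1) {k : ℕ} {g h : MapGerm 𝕜 p q} {e : Fin q → Ep 𝕜 p}
    (he : ∀ j, e j ∈ vanishIdeal 𝕜 p (k + 1))
    (hh : ∀ j, fieldDer ξ (h.comps j) + B.mulVec h.comps j - e j ∈ vanishIdeal 𝕜 p (k + 2))
    (hg : ∀ j, g.comps j - h.comps j ∈ vanishIdeal 𝕜 p (k + 1)) :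
    ∃ f : MapGerm 𝕜 p q, VK1Equiv V g f ∧
      ∀ j, f.comps j - (g.comps j - e j) ∈ vanishIdeal 𝕜 p (k + 2) := by
  obtain ⟨X, Φ, δ, C, H⟩ := exists_isUniformFlow hξV
  -- Time one is divided into N + 1 steps, each shorter than the existence time δ.
  obtain ⟨N, hN⟩ := exists_nat_one_div_lt H.pos
  set t : 𝕜 := ((N + 1 : ℕ) : 𝕜)⁻¹ with ht_def
  have ht : ‖t‖ < δ := by
    rw [ht_def, norm_inv, RCLike.norm_natCast]
    simpa using hN
  have main : ∀ n : ℕ, ∃ f : MapGerm 𝕜 p q, VK1Equiv V g f ∧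
      ∀ j, f.comps j - (g.comps j - Ep.const (n * t) * e j) ∈ vanishIdeal 𝕜 p (k + 2) := by
    intro n
    induction n with
    | zero => exact ⟨g, VK1Equiv.refl V g, fun j => by simp⟩
    | succ n ih =>
      obtain ⟨f, hf, hfe⟩ := ih
      -- Subtracting multiples of e does not affect agreement with h up to order k + 1, so the same
      -- ξ, B and e serve again.
      have hfh : ∀ j, f.comps j - h.comps j ∈ vanishIdeal 𝕜 p (k + 1) := fun j => by
        have h1 := vanishIdeal_anti (Nat.le_succ (k + 1)) (hfe j)
        have h2 := Ideal.mul_mem_left _ (Ep.const (p := p) (n * t)) (he j)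
        have := Ideal.sub_mem _ (Ideal.add_mem _ h1 (hg j)) h2
        convert this using 1
        ring
      obtain ⟨f', hf', hfe'⟩ := exists_vk1Equiv_sub_mem H ht hB he hh hfh
      refine ⟨f', hf.trans hf', fun j => ?_⟩
      have := Ideal.add_mem _ (hfe' j) (hfe j)
      convert this using 1
      rw [Nat.cast_succ, add_mul, one_mul, map_add]
      ring
  obtain ⟨f, hf, hfe⟩ := main (N + 1)
  refine ⟨f, hf, fun j => ?_⟩
  have h1 : ((N + 1 : ℕ) : 𝕜) * t = 1 := by
    rw [ht_def, mul_inv_cancel₀]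
    exact_mod_cast N.succ_ne_zero
  simpa only [h1, map_one, one_mul] using hfe j

end Step

/-! ### Homogeneous forms and generators of the ideals modulo high order -/

theorem eval_smul_of_isHomogeneous {P : MvPolynomial (Fin p) 𝕜} {n : ℕ} (hP : P.IsHomogeneous n)
    (t : 𝕜) (x : Fin p → 𝕜) :
    MvPolynomial.eval (t • x) P = t ^ n * MvPolynomial.eval x P := by
  rw [MvPolynomial.eval_eq', MvPolynomial.eval_eq', Finset.mul_sum]
  refine Finset.sum_congr rfl fun d hd => ?_
  have h1 : ∑ i, d i = n := by
    have := hP (MvPolynomial.mem_support_iff.1 hd)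
    rwa [show (Finsupp.weight (1 : Fin p → ℕ)) d = d.degree from
      (DFunLike.congr_fun Finsupp.degree_eq_weight_one d).symm, Finsupp.degree_eq_sum] at this
  simp only [Pi.smul_apply, smul_eq_mul, mul_pow, Finset.prod_mul_distrib]
  rw [Finset.prod_pow_eq_pow_sum, h1]
  ring

theorem isBigO_of_homogeneous {E F : Type*} [NormedAddCommGroup E] [NormedSpace 𝕜 E]
    [NormedAddCommGroup F] [NormedSpace 𝕜 F] {f : E → F} {n : ℕ} (hc : ContinuousAt f 0)
    (hf : ∀ (t : 𝕜) x, f (t • x) = t ^ n • f x) : f =O[𝓝 0] fun x => ‖x‖ ^ n := by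
  obtain ⟨r, hr, hb⟩ := Metric.eventually_nhds_iff_ball.1
    (hc.norm.eventually_le_const (lt_add_one _))
  set M := ‖f 0‖ + 1
  refine IsBigO.of_bound (M * (r / 2)⁻¹ ^ n) (Eventually.of_forall fun x => ?_)
  rw [norm_pow, norm_norm]
  rcases eq_or_ne x 0 with rfl | hx
  · have h1 : ‖f 0‖ = ‖(0 : 𝕜)‖ ^ n * ‖f 0‖ := by
      rw [← norm_pow, ← norm_smul, ← hf, zero_smul]
    have h2 : ‖f 0‖ ≤ M := (lt_add_one _).le
    rcases Nat.eq_zero_or_pos n with rfl | hn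
    · simpa using h2
    · rw [norm_zero, zero_pow hn.ne', zero_mul] at h1
      rw [h1]
      positivity
  · have hx0 : 0 < ‖x‖ := norm_pos_iff.2 hx
    -- With this scaling t⁻¹ • x has norm r / 2, so it lies in the ball where f is bounded by M.
    set t : 𝕜 := ((‖x‖ / (r / 2) : ℝ) : 𝕜) with ht
    have htn : ‖t‖ = ‖x‖ / (r / 2) := by
      rw [ht, RCLike.norm_ofReal, abs_of_pos (by positivity)]
    have ht0 : t ≠ 0 := by
      rw [← norm_pos_iff, htn]
      positivity
    have hy : t⁻¹ • x ∈ Metric.ball (0 : E) r := by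
      rw [mem_ball_zero_iff, norm_smul, norm_inv, htn]
      have : (‖x‖ / (r / 2))⁻¹ * ‖x‖ = r / 2 := by field_simp
      rw [this]
      linarith
    have h1 := hf t (t⁻¹ • x)
    rw [smul_inv_smul₀ ht0] at h1
    rw [h1, norm_smul, norm_pow, htn, div_eq_mul_inv, mul_pow]
    have h2 := hb _ hy
    have h3 : 0 ≤ ‖x‖ ^ n * (r / 2)⁻¹ ^ n := by positivity
    nlinarith

theorem smoothNear_diag {n : ℕ} (T : ContinuousMultilinearMap 𝕜 (fun _ : Fin n => Fin p → 𝕜) 𝕜) :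
    SmoothNear 𝕜 (fun x => T fun _ => x) 0 :=
  ContDiff.smoothNear (T.contDiff.comp (contDiff_pi.2 fun _ => contDiff_id))

/-- A homogeneous form of degree `n` is a polynomial of degree `n` in the coordinates. -/
theorem mk_diag_mem {n : ℕ} (T : ContinuousMultilinearMap 𝕜 (fun _ : Fin n => Fin p → 𝕜) 𝕜) :
    Ep.mk (fun x => T fun _ => x) (smoothNear_diag T) ∈
      Ideal.span (Set.range (Ep.coord (𝕜 := 𝕜) (p := p))) ^ n := by
  have hs : ∀ r : Fin n → Fin p, SmoothNear 𝕜 (fun x : Fin p → 𝕜 => ∏ i, x (r i)) 0 := fun r =>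
    ContDiff.smoothNear (contDiff_prod fun i _ => contDiff_apply 𝕜 𝕜 (r i))
  have h : Ep.mk (fun x => T fun _ => x) (smoothNear_diag T) =
      ∑ r : Fin n → Fin p, Ep.mk
        (fun x => T (fun i => Pi.single (r i) 1) * ∏ i, x (r i))
        ((smoothNear_const _).fun_mul (hs r)) := by
    rw [Ep.mk_sum]
    refine Ep.mk_congr _ fun x => ?_
    conv_lhs => rw [pi_eq_sum_univ' x]
    rw [T.map_sum]
    refine Finset.sum_congr rfl fun r _ => ?_
    rw [T.map_smul_univ, smul_eq_mul, mul_comm]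
  rw [h]
  refine Ideal.sum_mem _ fun r _ => ?_
  rw [← Ep.mk_mul (smoothNear_const _) (hs r)]
  refine Ideal.mul_mem_left _ _ ?_
  rw [← Ep.mk_prod Finset.univ (fun i x => x (r i))
    (fun i => ContDiff.smoothNear (contDiff_apply 𝕜 𝕜 (r i))) (hs r)]
  have := Ideal.prod_mem_prod (s := Finset.univ) (x := fun i => Ep.coord (𝕜 := 𝕜) (r i))
    (I := fun _ => Ideal.span (Set.range (Ep.coord (𝕜 := 𝕜) (p := p))))
    fun i _ => Ideal.subset_span ⟨r i, rfl⟩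
  rwa [Finset.prod_const, Finset.card_univ, Fintype.card_fin] at this

theorem span_coord_le : Ideal.span (Set.range (Ep.coord (𝕜 := 𝕜) (p := p))) ≤ maxIdeal 𝕜 p := by
  rw [Ideal.span_le]
  rintro _ ⟨i, rfl⟩
  exact mk_mem_maxIdeal.2 rfl

/-- The maximal ideal is generated by the coordinates modulo germs of high order. -/
theorem maxIdeal_le_span_coord_sup (n : ℕ) :
    maxIdeal 𝕜 p ≤ Ideal.span (Set.range Ep.coord) ⊔ vanishIdeal 𝕜 p n := by
  intro a ha
  obtain ⟨f, hf, rfl⟩ := a.exists_rep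
  rw [mk_mem_maxIdeal] at ha
  have hc : ∀ j, SmoothNear 𝕜
      (fun x => ((j.factorial : 𝕜)⁻¹ • iteratedFDeriv 𝕜 j f 0) fun _ => x) 0 := fun j =>
    smoothNear_diag _
  have hts : SmoothNear 𝕜 (taylorSum 𝕜 n f) 0 := SmoothNear.fun_sum hc
  rw [← sub_add_cancel (Ep.mk f hf) (Ep.mk _ hts), add_comm]
  refine Submodule.add_mem_sup ?_ ?_
  · have : Ep.mk (taylorSum 𝕜 n f) hts = ∑ j ∈ Finset.range n, Ep.mk _ (hc j) := by
      rw [Ep.mk_sum]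
      rfl
    rw [this]
    refine Ideal.sum_mem _ fun j _ => ?_
    cases j with
    | zero =>
      have h0 : Ep.mk _ (hc 0) = 0 := Ep.mk_congr (smoothNear_const 0) fun x => by simp [ha]
      rw [h0]
      exact zero_mem _
    | succ j => exact Ideal.pow_le_self (Nat.succ_ne_zero j) (mk_diag_mem _)
  · rw [Ep.mk_sub, mk_mem_vanishIdeal]
    exact hf.sub_taylorSum_isBigO n

/-- The coordinates of 𝕜^q pull back to the components of h, and pullback by h does not lower the
order of vanishing. -/
theorem map_pullback_maxIdeal_le (h : MapGerm 𝕜 p q) (n : ℕ) :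
    (maxIdeal 𝕜 q).map h.pullback ≤ Ideal.span (Set.range h.comps) ⊔ vanishIdeal 𝕜 p n := by
  refine (Ideal.map_mono (maxIdeal_le_span_coord_sup n)).trans ?_
  rw [Ideal.map_sup, Ideal.map_span, ← Set.range_comp]
  refine sup_le_sup le_rfl (Ideal.map_le_iff_le_comap.2 fun a ha => ?_)
  exact pullback_mem_vanishIdeal h ha

/-- This supplies the rows of the matrix B: it turns an element of 𝔪 h^*(𝔪_q) into a combination of
the components of h with coefficients in 𝔪, up to any prescribed order. -/
theorem exists_sub_sum_mem {h : MapGerm 𝕜 p q} {a : Ep 𝕜 p}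
    (ha : a ∈ maxIdeal 𝕜 p * (maxIdeal 𝕜 q).map h.pullback) (n : ℕ) :
    ∃ b : Fin q → Ep 𝕜 p, (∀ l, b l ∈ vanishIdeal 𝕜 p 1) ∧
      a - ∑ l, b l * h.comps l ∈ vanishIdeal 𝕜 p n := by
  have h1 := Ideal.mul_mono_right (map_pullback_maxIdeal_le h n) ha
  rw [Ideal.mul_sup] at h1
  obtain ⟨y, hy, z, hz, rfl⟩ := Submodule.mem_sup.1 h1
  rw [← smul_eq_mul, ← Ideal.submodule_span_eq, Submodule.mem_ideal_smul_span_iff_exists_sum] at hy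
  obtain ⟨b, hb, rfl⟩ := hy
  refine ⟨b, fun l => ?_, ?_⟩
  · rw [vanishIdeal_one]
    exact hb l
  · have h2 : (b.sum fun l c => c • h.comps l) = ∑ l, b l * h.comps l :=
      Finsupp.sum_fintype _ _ fun l => zero_smul _ _
    rw [h2, add_sub_cancel_left]
    have h3 : maxIdeal 𝕜 p * vanishIdeal 𝕜 p n ≤ vanishIdeal 𝕜 p n := Ideal.mul_le_right
    exact h3 hz

theorem apply_mem_of_mem_smul_top {R : Type*} [CommRing R] {I : Ideal R} {w : Fin q → R}
    (hw : w ∈ I • (⊤ : Submodule R (Fin q → R))) (j : Fin q) : w j ∈ I := by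
  refine Submodule.smul_induction_on hw (fun r hr n _ => Ideal.mul_mem_right _ _ hr)
    fun x y hx hy => Ideal.add_mem _ hx hy

theorem mem_smul_top_of_apply_mem {R : Type*} [CommRing R] {I : Ideal R} {w : Fin q → R}
    (hw : ∀ j, w j ∈ I) : w ∈ I • (⊤ : Submodule R (Fin q → R)) := by
  rw [pi_eq_sum_univ' w]
  exact Submodule.sum_mem _ fun j _ => Submodule.smul_mem_smul (hw j) trivial

/-! ### Jets and orders of vanishing -/

theorem MapGerm.smoothNear_apply (h : MapGerm 𝕜 p q) (j : Fin q) :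
    SmoothNear 𝕜 (fun x => h.toFun x j) 0 :=
  h.smooth'.mono fun _ hx => contDiffAt_pi.1 hx j

theorem smoothNear_eval (P : MvPolynomial (Fin p) 𝕜) :
    SmoothNear 𝕜 (fun x => MvPolynomial.eval x P) 0 :=
  Eventually.of_forall fun x =>
    ((AnalyticOnNhd.eval_mvPolynomial P) x (Set.mem_univ x)).contDiffAt

theorem comps_sub_mem_of_jet_eq {k : ℕ} {g h : MapGerm 𝕜 p q} (hgh : jet k h = jet k g)
    (j : Fin q) : g.comps j - h.comps j ∈ vanishIdeal 𝕜 p (k + 1) := by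
  have h1 := (g.smooth'.sub_taylorSum_isBigO (k + 1)).sub (h.smooth'.sub_taylorSum_isBigO (k + 1))
  have h2 : (fun x => g.toFun x - h.toFun x) =O[𝓝 0] fun x => ‖x‖ ^ (k + 1) := by
    refine h1.congr_left fun x => ?_
    have : taylorSum 𝕜 (k + 1) h.toFun x = taylorSum 𝕜 (k + 1) g.toFun x := congrFun hgh x
    rw [this]
    abel
  exact (mk_mem_vanishIdeal (hf := (g.smoothNear_apply j).fun_sub (h.smoothNear_apply j))).2
    (isBigO_pi.1 h2 j)

/-- The homogeneous part of degree `n` of a component of a map germ. -/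
def homPart (n : ℕ) (g : MapGerm 𝕜 p q) (j : Fin q) :
    ContinuousMultilinearMap 𝕜 (fun _ : Fin n => Fin p → 𝕜) 𝕜 :=
  (ContinuousLinearMap.proj (R := 𝕜) (φ := fun _ : Fin q => 𝕜) j).compContinuousMultilinearMap
    ((n.factorial : 𝕜)⁻¹ • iteratedFDeriv 𝕜 n g.toFun 0)

theorem sum_smul_polyGerm_mem {k s : ℕ} {G : Fin s → Fin q → MvPolynomial (Fin p) 𝕜}
    (hG : ∀ i j, (G i j).IsHomogeneous (k + 1)) (α : Fin s → 𝕜) (j : Fin q) :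
    polyGerm (∑ i, α i • G i) j ∈ vanishIdeal 𝕜 p (k + 1) := by
  refine mk_mem_vanishIdeal.2 (isBigO_of_homogeneous (𝕜 := 𝕜) ?_ fun t x => ?_)
  · exact (MvPolynomial.continuous_eval _).continuousAt
  · refine eval_smul_of_isHomogeneous ?_ t x
    rw [Finset.sum_apply]
    refine MvPolynomial.IsHomogeneous.sum _ _ _ fun i _ => ?_
    rw [Pi.smul_apply, MvPolynomial.smul_eq_C_mul]
    simpa using (MvPolynomial.isHomogeneous_C (Fin p) (α i)).mul (hG i j)

/-- If `f` is `g` with its part of degree `k + 1` replaced by `∑ i, α i • G i`, modulo higher order,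
then its `k + 1`-jet is as expected. -/
theorem jet_succ_eq {k s : ℕ} {G : Fin s → Fin q → MvPolynomial (Fin p) 𝕜}
    (hG : ∀ i j, (G i j).IsHomogeneous (k + 1)) (α : Fin s → 𝕜) {f g h : MapGerm 𝕜 p q}
    (hgh : jet k h = jet k g)
    (hf : ∀ j, f.comps j - (g.comps j - Ep.mk _ (smoothNear_diag (homPart (k + 1) g j)) +
      polyGerm (∑ i, α i • G i) j) ∈ vanishIdeal 𝕜 p (k + 2)) (x : Fin p → 𝕜) :
    jet (k + 1) f x = jet k h x + ∑ i, α i • fun j => MvPolynomial.eval x (G i j) := by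
  set Q : (Fin p → 𝕜) → (Fin q → 𝕜) := fun x => ∑ i, α i • fun j => MvPolynomial.eval x (G i j)
    with hQ
  -- These are the expected homogeneous parts of f; by uniqueness of the Taylor expansion it is
  -- enough that their sum approximates f to order k + 2.
  set c : ℕ → (Fin p → 𝕜) → (Fin q → 𝕜) := fun n x =>
    if n = k + 1 then Q x else ((n.factorial : 𝕜)⁻¹) • iteratedFDeriv 𝕜 n h.toFun 0 (fun _ => x)
    with hc
  have hcsum : ∀ x, ∑ n ∈ Finset.range (k + 2), c n x = jet k h x + Q x := by
    intro x
    rw [Finset.sum_range_succ, jet]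
    congr 1
    · refine Finset.sum_congr rfl fun n hn => ?_
      simp [hc, (Finset.mem_range.1 hn).ne]
    · simp [hc]
  have hchom : ∀ n < k + 2, ∀ (t : 𝕜) x, c n (t • x) = t ^ n • c n x := by
    intro n _ t x
    simp only [hc]
    split_ifs with hn
    · subst hn
      simp only [hQ, Finset.smul_sum]
      refine Finset.sum_congr rfl fun i _ => ?_
      ext j
      simp only [Pi.smul_apply, smul_eq_mul, eval_smul_of_isHomogeneous (hG i j)]
      ring
    · rw [iteratedFDeriv_diag_smul, smul_comm]
  have hO : (fun x => f.toFun x - ∑ n ∈ Finset.range (k + 2), c n x) =O[𝓝 0]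
      fun x => ‖x‖ ^ (k + 2) := by
    refine isBigO_pi.2 fun j => ?_
    have h1 := (mk_mem_vanishIdeal (hf := (f.smoothNear_apply j).fun_sub
      (((g.smoothNear_apply j).fun_sub (smoothNear_diag (homPart (k + 1) g j))).fun_add
        (smoothNear_eval ((∑ i, α i • G i) j))))).1 (hf j)
    have h2 := isBigO_pi.1 (g.smooth'.sub_taylorSum_isBigO (k + 2)) j
    refine (h1.add h2).congr_left fun x => ?_
    have h3 : taylorSum 𝕜 (k + 2) g.toFun x j = jet k h x j + homPart (k + 1) g j fun _ => x := by
      rw [hgh, taylorSum, Finset.sum_range_succ]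
      rfl
    have h4 : MvPolynomial.eval x ((∑ i, α i • G i) j) = Q x j := by
      simp [hQ, Finset.sum_apply]
    rw [hcsum]
    simp only [Pi.sub_apply, Pi.add_apply, h3, h4]
    ring
  have key := f.smooth'.taylorSum_eq hchom hO
  rw [← hcsum, jet]
  exact Finset.sum_congr rfl fun n hn => key n (Finset.mem_range.1 hn) x

end

end VK

end

/-! ### The complete transversal theorem -/

theorem theorem3p3 {𝕜 : Type*} [RCLike 𝕜] {p q : ℕ} (h : VK.MapGerm 𝕜 p q)
    (V : Set (Fin p → 𝕜)) (hV : VK.ThetaFG V) (k s : ℕ)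
    (G : Fin s → Fin q → MvPolynomial (Fin p) 𝕜)
    (hG : ∀ i j, (G i j).IsHomogeneous (k + 1))
    (hT : (VK.powTheta 𝕜 p q (k + 1) : Set (Fin q → VK.Ep 𝕜 p)) ⊆
      VK.tangentK1 V h + VK.polyGerm '' (Submodule.span 𝕜 (Set.range G) : Set _) +
        (VK.powTheta 𝕜 p q (k + 2) : Set (Fin q → VK.Ep 𝕜 p)))
    (g : VK.MapGerm 𝕜 p q) (hg : VK.jet k h = VK.jet k g) :
    ∃ (f : VK.MapGerm 𝕜 p q) (α : Fin s → 𝕜), VK.VK1Equiv V g f ∧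
      ∀ x : Fin p → 𝕜, VK.jet (k + 1) f x =
        VK.jet k h x + ∑ i, α i • fun j => MvPolynomial.eval x (G i j) := by
  -- The hypothesis is applied to the degree k + 1 form of g and not to g - h: a form is a
  -- polynomial in the coordinates, so its membership in 𝔪^(k+1) is purely algebraic.
  set φ : Fin q → VK.Ep 𝕜 p := fun j =>
    VK.Ep.mk _ (VK.smoothNear_diag (VK.homPart (k + 1) g j)) with hφ
  have hφm : ∀ j, φ j ∈ VK.maxIdeal 𝕜 p ^ (k + 1) := fun j =>
    Ideal.pow_right_mono VK.span_coord_le _ (VK.mk_diag_mem _)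
  obtain ⟨_, ⟨_, ⟨_, ⟨ξ, hξ, rfl⟩, w, hw, rfl⟩, _, ⟨P, hP, rfl⟩, rfl⟩, r, hr, hsum⟩ :=
    hT (VK.mem_smul_top_of_apply_mem hφm)
  obtain ⟨α, rfl⟩ := (Submodule.mem_span_range_iff_exists_fun 𝕜).1 hP
  choose B hB hwB using fun j =>
    VK.exists_sub_sum_mem (VK.apply_mem_of_mem_smul_top hw j) (k + 2)
  have hφO : ∀ j, φ j ∈ VK.vanishIdeal 𝕜 p (k + 1) := fun j => VK.maxIdeal_pow_le _ (hφm j)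
  have hrO : ∀ j, r j ∈ VK.vanishIdeal 𝕜 p (k + 2) := fun j =>
    VK.maxIdeal_pow_le _ (VK.apply_mem_of_mem_smul_top hr j)
  have hsumj : ∀ j, VK.fieldDer ξ (h.comps j) + w j + VK.polyGerm (∑ i, α i • G i) j + r j = φ j :=
    fun j => congrFun hsum j
  set e : Fin q → VK.Ep 𝕜 p := fun j => φ j - VK.polyGerm (∑ i, α i • G i) j with he
  have heO : ∀ j, e j ∈ VK.vanishIdeal 𝕜 p (k + 1) := fun j =>
    Ideal.sub_mem _ (hφO j) (VK.sum_smul_polyGerm_mem hG α j)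
  have hh : ∀ j, VK.fieldDer ξ (h.comps j) + (Matrix.of B).mulVec h.comps j - e j ∈
      VK.vanishIdeal 𝕜 p (k + 2) := by
    intro j
    -- Since e = ξ(h) + w + r, the expression equals -((w - B h) + r).
    have h1 := neg_mem (Ideal.add_mem _ (hwB j) (hrO j))
    convert h1 using 1
    simp only [he, ← hsumj j, Matrix.mulVec, dotProduct, Matrix.of_apply]
    ring
  obtain ⟨f, hf, hfe⟩ := VK.exists_vk1Equiv_sub_mem_of_theta1 hξ (B := Matrix.of B) hB heO hh
    (VK.comps_sub_mem_of_jet_eq hg)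
  refine ⟨f, α, hf, VK.jet_succ_eq hG α hg fun j => ?_⟩
  convert hfe j using 1
  simp only [he, hφ]
  ring
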